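/- Let $\mathcal F$ be the set of (classes of) functions $f\in L^1(S^1,\mathbb R)$ on the unit circle $S^1=\{e^{it}\}$ with values in $[0,1]$ almost everywhere (the integrable fuzzy subsets of $S^1$). For $n\ge 0$ let $\mathcal G_n\subset\mathcal F$ be the set of characteristic functions of unions of $n$ nondegenerate, pairwise disjoint closed arcs, i.e. of sets $\bigcup_{r=1}^n\{e^{it}:\xi_r\le t\le\eta_r\}$ with $\xi_1<\eta_1<\xi_2<\eta_2<\dots<\xi_n<\eta_n<\xi_1+2\pi$ (so $\mathcal G_0=\{0\}$). For $f\in L^1(S^1,\mathbb R)$ put $c_k=\frac1{2\pi}\int_0^{2\pi}f(t)e^{ikt}\,dt$ and $h(f)(z)=\sum_{k\ge1}c_kz^k$ for $|z|<1$. The nonlinear coefficients $\mathcal N(f)=(s_k)_{k\in\mathbb Z}$ are defined by $$s_0=2\sin(\pi c_0),\qquad e^{-2\pi i\,h(f)(z)}=1-i\,e^{i\pi c_0}\sum_{k\ge1}s_kz^k,\qquad s_{-k}=\overline{s_k}\quad(k\ge1).$$ For a Hermitian sequence $s=(s_k)_{k\in\mathbb Z}$ (that is, $s_{-k}=\overline{s_k}$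 for all $k$) let $D_k(s)=\det(s_{j-i})_{0\le i,j\le k}$, $k\ge0$, which is real. For $n\ge0$ let $V_n$ be the set of Hermitian sequences with $D_k(s)>0$ for $k<n$ and $D_k(s)=0$ for all $k\ge n$ (sequences of order $n$), let $V_\infty$ be the set of Hermitian sequences with $D_k(s)>0$ for all $k\ge 0$, and let $V=\bigcup_{n\ge0}V_n\cup V_\infty$. Then: 1. $\mathcal N(\mathcal F)=\{s\in V: s_0\le 2\}$; 2. $\mathcal N(\mathcal G_n)=\{s\in V_n: s_0\le 2\}$ for every $n\ge0$; 3. for every $f\in\mathcal F$ and $n\ge1$: $\mathcal N(f)\in V_n$ if and only if $f\in\mathcal G_n$; 4. for every $f\in\mathcal F$: $\mathcal N(f)\in V_0$ if and only if $f=0$ almost everywhere or $f=1$ almost everywhere. -/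

import Mathlib

open MeasureTheory Filter

noncomputable section

namespace FuzzyCircle

instance factTwoPiPos : Fact (0 < 2 * Real.pi) := ⟨Real.two_pi_pos⟩

/-- The circle `ℝ / 2πℤ`; the class of `t` stands for the point `e^{it}`. -/
abbrev S1 : Type := AddCircle (2 * Real.pi)

/-- Normalized arc length `dt / 2π` on the circle. -/
abbrev arcMeasure : Measure S1 := AddCircle.haarAddCircle

/-- `L¹(S¹, ℝ)`. -/
abbrev L1 : Type := Lp ℝ 1 arcMeasure

/-- The integrable fuzzy subsets of the circle: the elements of `L¹(S¹, [0,1])`. -/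
def fuzzySets : Set L1 := {f | ∀ᵐ t ∂arcMeasure, f t ∈ Set.Icc (0 : ℝ) 1}

/-- Union of the closed arcs `{e^{it} : ξ r ≤ t ≤ η r}`. -/
def arcUnion {n : ℕ} (ξ η : Fin n → ℝ) : Set S1 :=
  ⋃ r, (fun t : ℝ => (t : S1)) '' Set.Icc (ξ r) (η r)

/-- The crisp subsets of order `n`: the classes of characteristic functions of unions of `n`
nondegenerate, pairwise disjoint closed arcs
`ξ₁ < η₁ < ξ₂ < η₂ < ⋯ < ξₙ < ηₙ < ξ₁ + 2π`. -/
def crispSets (n : ℕ) : Set L1 :=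
  {f | ∃ ξ η : Fin n → ℝ,
    (∀ r, ξ r < η r) ∧ (∀ r r', r < r' → η r < ξ r') ∧ (∀ r r', η r < ξ r' + 2 * Real.pi) ∧
    (f : S1 → ℝ) =ᵐ[arcMeasure] (arcUnion ξ η).indicator (fun _ => (1 : ℝ))}

/-- Fourier coefficients `c_k(f) = (1/2π) ∫ f(t) e^{ikt} dt`. -/
def coeff (f : L1) (k : ℤ) : ℂ := ∫ t : S1, (f t : ℂ) * fourier k t ∂arcMeasure

/-- The Hardy function without its constant term, `z ↦ ∑_{k ≥ 1} c_k(f) z^k`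
(convergent for `|z| < 1`). -/
def hardy (f : L1) (z : ℂ) : ℂ := ∑' k : ℕ, coeff f ((k : ℤ) + 1) * z ^ (k + 1)

/-- The function `e^{-2π i h(f)}`, holomorphic on the open unit disk. -/
def expHardy (f : L1) (z : ℂ) : ℂ :=
  Complex.exp (-(2 * Real.pi * Complex.I) * hardy f z)

/-- The `k`-th Taylor coefficient at `0` of `e^{-2π i h(f)}`. -/
def taylorCoeff (f : L1) (k : ℕ) : ℂ := iteratedDeriv k (expHardy f) 0 / (k.factorial : ℂ)

/-- The rescaled coefficients `s_k`, `k ≥ 1`, solving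
`e^{-2π i h(f)(z)} = 1 - i e^{iπ c₀} ∑_{k ≥ 1} s_k z^k`. -/
def rescaledCoeff (f : L1) (k : ℕ) : ℂ :=
  Complex.I * Complex.exp (-(Complex.I * Real.pi * coeff f 0)) * taylorCoeff f k

/-- The nonlinear coefficients of `f`: `s₀ = 2 sin (π c₀)`, `s_k` as above for `k ≥ 1`, and
`s_{-k}` the conjugate of `s_k`. -/
def nonlinear (f : L1) : ℤ → ℂ
  | Int.ofNat 0 => 2 * Complex.sin (Real.pi * coeff f 0)
  | Int.ofNat (k + 1) => rescaledCoeff f (k + 1)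
  | Int.negSucc k => (starRingEnd ℂ) (rescaledCoeff f (k + 1))

/-- Hermitian sequences: `s_{-k}` is the conjugate of `s_k`. -/
def IsHermitianSeq (s : ℤ → ℂ) : Prop := ∀ k, s (-k) = (starRingEnd ℂ) (s k)

/-- The `(k+1) × (k+1)` Toeplitz matrix with first row `s₀, s₁, …, s_k`. -/
def toeplitz (s : ℤ → ℂ) (k : ℕ) : Matrix (Fin (k + 1)) (Fin (k + 1)) ℂ :=
  Matrix.of fun i j => s ((j : ℤ) - (i : ℤ))

/-- The Toeplitz determinant `D_k`, as a real number; it is only used for Hermitian sequences,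
whose Toeplitz determinants are real by `toeplitzDet_eq`. -/
def toeplitzDet (s : ℤ → ℂ) (k : ℕ) : ℝ := (toeplitz s k).det.re

theorem toeplitzDet_eq {s : ℤ → ℂ} (hs : IsHermitianSeq s) (k : ℕ) :
    ((toeplitzDet s k : ℝ) : ℂ) = (toeplitz s k).det := by
  have hH : (toeplitz s k).conjTranspose = toeplitz s k := by
    ext i j
    have h := hs ((i : ℤ) - (j : ℤ))
    rw [neg_sub] at h
    simp only [Matrix.conjTranspose_apply, toeplitz, Matrix.of_apply]
    exact h.symm
  have hd : (starRingEnd ℂ) (toeplitz s k).det = (toeplitz s k).det := by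
    have h := Matrix.det_conjTranspose (toeplitz s k)
    rw [hH] at h
    exact h.symm
  exact Complex.conj_eq_iff_re.mp hd

/-- Sequences of order `n`: `D_k > 0` for `k < n` and `D_k = 0` for `k ≥ n`. -/
def seqOfOrder (n : ℕ) : Set (ℤ → ℂ) :=
  {s | IsHermitianSeq s ∧ (∀ k < n, 0 < toeplitzDet s k) ∧ ∀ k ≥ n, toeplitzDet s k = 0}

/-- Sequences of infinite order: `D_k > 0` for all `k`. -/
def seqOfInfiniteOrder : Set (ℤ → ℂ) :=
  {s | IsHermitianSeq s ∧ ∀ k, 0 < toeplitzDet s k}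

/-- Sequences of finite or infinite order. -/
def seqV : Set (ℤ → ℂ) := (⋃ n, seqOfOrder n) ∪ seqOfInfiniteOrder

end FuzzyCircle

end

open FuzzyCircle

/-! The bridge between `f` and `s` is the function `F = rotation c₀ * expHardy f = rotation c₀ +
∑_{k ≥ 1} s_k z^k`, where `rotation c₀ = i e^{-iπc₀}` has real part `sin(πc₀) = s₀/2`. Up to an
imaginary constant, `F` is the Carathéodory function of the sequence `s`. Its argument is `π/2 -
πu`, with `u = c₀ + 2 Re h` the harmonic extension of `f`. So `0 ≤ u ≤ 1` corresponds to `Re F ≥ 0`,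
that is, to positivity of all Toeplitz forms of `s`.

Forward: the Poisson integral gives `u ∈ [0,1]` (`harmonic_mem_Icc`), hence `Re F ≥ 0`, hence
positive Toeplitz forms (`posToeplitz_of_harmonic_nonneg`). Backward: positive forms give `Re F ≥ 0`
(`PosToeplitz.harmonic_nonneg`). As `s₀ ≤ 2`, the equation `sin(πc) = s₀/2` has a solution `c`, and
the logarithm of `F` gives a harmonic function with values in `[0,1]`, whose `L²` boundary values
are the required `f` (`exists_nonlinear_eq`).

That positivity of the forms is the same as `s ∈ V` rests on Carathéodory's theorem
(`exists_isAtomic`): a sequence of order `n` is the moment sequence of `n` positive masses on the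
circle. The first `n + 1` terms come from a unitary operator on an `n`-dimensional space, the
vanishing of all later determinants forces `s` to follow its orbit, and the spectral decomposition
provides the masses.

For the arcs `[ξ_r, η_r]`, the function `expHardy f` equals `∏ (1 - e^{iη_r} z) / ∏ (1 - e^{iξ_r}
z)`, and partial fractions exhibit `s` as atomic with positive masses at the points `e^{iξ_r}`.
Conversely, for an atomic `s` the numerator of `F` is on the circle a nonvanishing factor times a
real function that changes sign between consecutive atoms. Its zeros are the right end points `η_r`
(`exists_arcSystem_zeros`). The crisp set `g` so obtained has the same Hardy function as `f`, so `f
- g` is constant, and the constant is `0` because `g` takes both values `0` and `1`. -/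

namespace FuzzyCircle

/-! ### Positivity of Toeplitz matrices and determinants -/

open scoped ComplexOrder MatrixOrder ComplexConjugate InnerProductSpace Matrix

/-- The `n × n` Toeplitz matrix of `s`. -/
def toeplitzMat (s : ℤ → ℂ) (n : ℕ) : Matrix (Fin n) (Fin n) ℂ :=
  Matrix.of fun i j => s ((j : ℤ) - (i : ℤ))

theorem toeplitzMat_succ (s : ℤ → ℂ) (k : ℕ) : toeplitzMat s (k + 1) = toeplitz s k := rfl

theorem isHermitian_toeplitzMat {s : ℤ → ℂ} (hs : IsHermitianSeq s) (n : ℕ) :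
    (toeplitzMat s n).IsHermitian := by
  ext i j
  have h := hs ((i : ℤ) - (j : ℤ))
  rw [neg_sub] at h
  simp only [Matrix.conjTranspose_apply, toeplitzMat, Matrix.of_apply]
  exact h.symm

/-- All Toeplitz matrices of `s` are positive semidefinite. -/
def PosToeplitz (s : ℤ → ℂ) : Prop := ∀ n, (toeplitzMat s n).PosSemidef

/-- A Hermitian matrix with positive definite leading block and positive determinant is
positive definite. -/
theorem posDef_of_leading_block {n : ℕ} {M : Matrix (Fin (n + 1)) (Fin (n + 1)) ℂ}
    (hM : M.IsHermitian) (hA : (M.submatrix Fin.castSucc Fin.castSucc).PosDef)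
    (hdet : 0 < M.det) : M.PosDef := by
  let e : Fin n ⊕ Fin 1 ≃ Fin (n + 1) := finSumFinEquiv
  set N := M.submatrix e e with hN
  have hNH : N.IsHermitian := hM.submatrix e
  have hA' : N.toBlocks₁₁.PosDef := hA
  have hNdet : 0 < N.det := by rw [hN, Matrix.det_submatrix_equiv_self]; exact hdet
  have hC : N.toBlocks₂₁ = N.toBlocks₁₂ᴴ := by
    ext i j
    exact (hNH.apply (Sum.inr i) (Sum.inl j)).symm
  have hNb : N = Matrix.fromBlocks N.toBlocks₁₁ N.toBlocks₁₂ N.toBlocks₁₂ᴴ N.toBlocks₂₂ := by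
    rw [← hC, Matrix.fromBlocks_toBlocks]
  have : Invertible N.toBlocks₁₁ := hA'.isUnit.invertible
  -- The determinant is that of the leading block times the `1 × 1` Schur complement, which is
  -- therefore positive. This makes `N` positive semidefinite, and its nonzero determinant makes it
  -- definite.
  have hdet2 := hNdet
  rw [hNb, Matrix.det_fromBlocks₁₁] at hdet2
  have hApos : 0 < N.toBlocks₁₁.det := hA'.det_pos
  have hS := pos_of_mul_pos_right hdet2 hApos.le
  rw [Matrix.invOf_eq_nonsing_inv] at hS
  have hNpsd : N.PosSemidef := by
    rw [hNb, Matrix.PosDef.fromBlocks₁₁ _ _ hA']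
    refine ⟨?_, fun x => ?_⟩
    · refine Matrix.IsHermitian.sub ?_ ?_
      · ext i j
        exact hNH.apply (Sum.inr i) (Sum.inr j)
      · exact Matrix.isHermitian_conjTranspose_mul_mul _ hA'.1.inv
    · rw [Matrix.det_fin_one] at hS
      rw [Finsupp.sum_fintype _ _ (by simp), Fin.sum_univ_one,
        Finsupp.sum_fintype _ _ (by simp), Fin.sum_univ_one]
      exact star_left_conjugate_nonneg hS.le (x 0)
  have hNpd : N.PosDef := hNpsd.posDef_iff_det_ne_zero.mpr hNdet.ne'
  have := hNpd.submatrix e.symm.injective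
  rwa [hN, Matrix.submatrix_submatrix, e.self_comp_symm, Matrix.submatrix_id_id] at this

theorem posDef_toeplitzMat {s : ℤ → ℂ} (hs : IsHermitianSeq s) {n : ℕ}
    (h : ∀ k < n, 0 < toeplitzDet s k) : (toeplitzMat s n).PosDef := by
  induction n with
  | zero =>
    refine ⟨isHermitian_toeplitzMat hs 0, fun x hx => absurd (Subsingleton.elim x 0) hx⟩
  | succ n ih =>
    refine posDef_of_leading_block (isHermitian_toeplitzMat hs _) (ih fun k hk => h k (by omega)) ?_
    rw [toeplitzMat_succ, ← toeplitzDet_eq hs]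
    exact_mod_cast h n (by omega)

theorem PosToeplitz.isHermitianSeq {s : ℤ → ℂ} (hs : PosToeplitz s) : IsHermitianSeq s := by
  have key : ∀ k : ℕ, s (-(k : ℤ)) = conj (s k) := fun k => by
    have := ((hs (k + 1)).1.apply ⟨k, by omega⟩ ⟨0, by omega⟩).symm
    simpa [toeplitzMat] using this
  intro k
  obtain ⟨m, rfl | rfl⟩ := k.eq_nat_or_neg
  · exact key m
  · rw [key m, neg_neg, Complex.conj_conj]

/-- A semidefinite matrix with nonzero determinant is definite, and so are its leading blocks. Hence
after one vanishing determinant all later ones vanish, and the order is the first index where this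
happens. -/
theorem PosToeplitz.mem_seqV {s : ℤ → ℂ} (hs : PosToeplitz s) : s ∈ seqV := by
  classical
  have hH := hs.isHermitianSeq
  have hnn : ∀ k, 0 ≤ toeplitzDet s k := fun k => by
    have : 0 ≤ (toeplitz s k).det := (hs (k + 1)).det_nonneg
    exact (Complex.le_def.mp this).1
  by_cases h : ∃ k, toeplitzDet s k = 0
  · refine Or.inl (Set.mem_iUnion.mpr ⟨Nat.find h, hH, fun k hk => ?_, fun k hk => ?_⟩)
    · exact lt_of_le_of_ne (hnn k) (Ne.symm (Nat.find_min h hk))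
    · by_contra hne
      have h0 : (toeplitzMat s (k + 1)).det ≠ 0 := by
        rw [toeplitzMat_succ, ← toeplitzDet_eq hH]
        exact_mod_cast hne
      have hpd := (hs (k + 1)).posDef_iff_det_ne_zero.mpr h0
      have hsub : (toeplitzMat s (Nat.find h + 1)).PosDef :=
        hpd.submatrix (Fin.castLE_injective (by omega : Nat.find h + 1 ≤ k + 1))
      have := hsub.det_pos.ne'
      rw [toeplitzMat_succ, ← toeplitzDet_eq hH] at this
      exact this (by exact_mod_cast Nat.find_spec h)
  · push Not at h
    exact Or.inr ⟨hH, fun k => lt_of_le_of_ne (hnn k) (h k).symm⟩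

theorem dotProduct_toeplitzMat (s : ℤ → ℂ) (n : ℕ) (v : Fin n → ℂ) :
    star v ⬝ᵥ (toeplitzMat s n *ᵥ v) =
      ∑ i : Fin n, ∑ j : Fin n, conj (v i) * v j * s ((j : ℤ) - (i : ℤ)) := by
  simp only [dotProduct, Matrix.mulVec, toeplitzMat, Matrix.of_apply, Finset.mul_sum, Pi.star_apply,
    RCLike.star_def]
  exact Finset.sum_congr rfl fun i _ => Finset.sum_congr rfl fun j _ => by ring

/-- Positivity of the real parts of the Toeplitz forms of a Hermitian sequence. -/
theorem posToeplitz_of_re_nonneg {s : ℤ → ℂ} (hs : IsHermitianSeq s)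
    (h : ∀ (n : ℕ) (v : Fin n → ℂ),
      0 ≤ (∑ i : Fin n, ∑ j : Fin n, conj (v i) * v j * s ((j : ℤ) - (i : ℤ))).re) :
    PosToeplitz s := by
  intro n
  have hH := isHermitian_toeplitzMat hs n
  refine Matrix.PosSemidef.of_dotProduct_mulVec_nonneg hH fun v => ?_
  have him : (star v ⬝ᵥ (toeplitzMat s n *ᵥ v)).im = 0 := hH.im_star_dotProduct_mulVec_self v
  rw [Complex.le_def]
  refine ⟨?_, him.symm⟩
  rw [dotProduct_toeplitzMat]
  exact h n v

end FuzzyCircle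

/-! ### Moment sequences of finitely supported measures -/

namespace FuzzyCircle

open scoped ComplexOrder MatrixOrder ComplexConjugate InnerProductSpace Matrix

/-- `s` is the moment sequence of the measure with masses `w μ > 0` at the points `μ ∈ S` of the
unit circle. -/
def IsAtomic (s : ℤ → ℂ) (S : Finset ℂ) (w : ℂ → ℝ) : Prop :=
  (∀ μ ∈ S, ‖μ‖ = 1 ∧ 0 < w μ) ∧ ∀ k : ℤ, s k = ∑ μ ∈ S, (w μ : ℂ) * μ ^ k

theorem conj_zpow_of_norm_eq_one {μ : ℂ} (h : ‖μ‖ = 1) (k : ℤ) : conj (μ ^ k) = μ ^ (-k) := by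
  rw [map_zpow₀, ← Complex.inv_eq_conj h, inv_zpow, zpow_neg]

theorem ne_zero_of_norm_eq_one {μ : ℂ} (h : ‖μ‖ = 1) : μ ≠ 0 := by
  rintro rfl
  simp at h

namespace IsAtomic

variable {s : ℤ → ℂ} {S : Finset ℂ} {w : ℂ → ℝ}

theorem isHermitianSeq (h : IsAtomic s S w) : IsHermitianSeq s := by
  intro k
  rw [h.2, h.2, map_sum]
  refine Finset.sum_congr rfl fun μ hμ => ?_
  rw [map_mul, Complex.conj_ofReal, conj_zpow_of_norm_eq_one (h.1 μ hμ).1]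

/-- On the unit circle `μ^{j-i} = conj(μ^i) μ^j`, so each atom contributes a multiple of a square
`|∑ v_j μ^j|²`. -/
theorem form_eq (h : IsAtomic s S w) (n : ℕ) (v : Fin n → ℂ) :
    ∑ i : Fin n, ∑ j : Fin n, conj (v i) * v j * s ((j : ℤ) - (i : ℤ)) =
      ((∑ μ ∈ S, w μ * Complex.normSq (∑ j, v j * μ ^ (j : ℕ)) : ℝ) : ℂ) := by
  push_cast
  simp_rw [h.2, Finset.mul_sum, Complex.normSq_eq_conj_mul_self, map_sum, Finset.sum_mul_sum,
    Finset.mul_sum]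
  have : ∀ i : Fin n, ∑ j : Fin n, ∑ μ ∈ S,
      conj (v i) * v j * ((w μ : ℂ) * μ ^ ((j : ℤ) - (i : ℤ))) = ∑ μ ∈ S, ∑ j : Fin n,
      (w μ : ℂ) * (conj (v i * μ ^ (i : ℕ)) * (v j * μ ^ (j : ℕ))) := fun i => by
    rw [Finset.sum_comm]
    refine Finset.sum_congr rfl fun μ hμ => Finset.sum_congr rfl fun j _ => ?_
    have h1 := (h.1 μ hμ).1
    have h2 : conj (μ ^ (i : ℕ)) = μ ^ (-(i : ℤ)) := by
      rw [← conj_zpow_of_norm_eq_one h1, zpow_natCast]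
    rw [map_mul, h2, sub_eq_add_neg, zpow_add₀ (ne_zero_of_norm_eq_one h1), zpow_natCast]
    ring
  simp_rw [this]
  rw [Finset.sum_comm]

theorem posToeplitz (h : IsAtomic s S w) : PosToeplitz s := by
  refine posToeplitz_of_re_nonneg h.isHermitianSeq fun n v => ?_
  rw [h.form_eq, Complex.ofReal_re]
  exact Finset.sum_nonneg fun μ hμ => mul_nonneg (h.1 μ hμ).2.le (Complex.normSq_nonneg _)

/-- A null vector of the form is the coefficient vector of a polynomial of degree less than `n` that
vanishes at all of the at least `n` atoms. -/
theorem posDef_of_le_card (h : IsAtomic s S w) {n : ℕ} (hn : n ≤ S.card) :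
    (toeplitzMat s n).PosDef := by
  rw [(h.posToeplitz n).posDef_iff_det_ne_zero]
  intro hdet
  obtain ⟨v, hv0, hv⟩ := Matrix.exists_mulVec_eq_zero_iff.mpr hdet
  have h1 : star v ⬝ᵥ (toeplitzMat s n *ᵥ v) = 0 := by rw [hv, dotProduct_zero]
  rw [dotProduct_toeplitzMat, h.form_eq] at h1
  have h2 := (Finset.sum_eq_zero_iff_of_nonneg fun μ hμ =>
    mul_nonneg (h.1 μ hμ).2.le (Complex.normSq_nonneg _)).mp (Complex.ofReal_eq_zero.mp h1)
  have h3 : ∀ μ ∈ S, ∑ j, v j * μ ^ (j : ℕ) = 0 := fun μ hμ =>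
    Complex.normSq_eq_zero.mp
      ((mul_eq_zero.mp (h2 μ hμ)).resolve_left (h.1 μ hμ).2.ne')
  let p : Polynomial ℂ := ∑ j : Fin n, Polynomial.C (v j) * Polynomial.X ^ (j : ℕ)
  have hpc : ∀ j : Fin n, p.coeff j = v j := fun j => by
    simp only [p, Polynomial.finsetSum_coeff, Polynomial.coeff_C_mul, Polynomial.coeff_X_pow]
    rw [Finset.sum_eq_single j (fun i _ hij => by simp [Fin.val_inj, hij.symm]) (by simp)]
    simp
  refine hv0 (funext fun j => ?_)
  have hnpos : 0 < n := j.pos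
  have hdeg : p.natDegree < n := by
    refine lt_of_le_of_lt (Polynomial.natDegree_sum_le_of_forall_le (n := n - 1) _ _ fun i _ => ?_)
      (by omega)
    exact (Polynomial.natDegree_C_mul_X_pow_le _ _).trans (by omega)
  have hp : p = 0 := by
    refine Polynomial.eq_zero_of_natDegree_lt_card_of_eval_eq_zero' p S (fun μ hμ => ?_)
      (hdeg.trans_le hn)
    simp only [p, Polynomial.eval_finsetSum, Polynomial.eval_mul, Polynomial.eval_C,
      Polynomial.eval_pow, Polynomial.eval_X]
    exact h3 μ hμ
  rw [← hpc, hp, Polynomial.coeff_zero, Pi.zero_apply]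

/-- The coefficients of `∏ (X - μ)`, taken over the atoms, form a nonzero null vector. -/
theorem det_eq_zero (h : IsAtomic s S w) {n : ℕ} (hn : S.card < n) :
    (toeplitzMat s n).det = 0 := by
  let p : Polynomial ℂ := ∏ μ ∈ S, (Polynomial.X - Polynomial.C μ)
  have hdeg : p.natDegree = S.card := Polynomial.natDegree_finsetProd_X_sub_C_eq_card S id
  have hmon : p.Monic := Polynomial.monic_prod_X_sub_C _ S
  refine Matrix.exists_mulVec_eq_zero_iff.mp ⟨fun j => p.coeff j, fun h0 => ?_, funext fun i => ?_⟩
  · have := congrFun h0 ⟨S.card, hn⟩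
    simp only [Pi.zero_apply] at this
    rw [← hdeg] at this
    exact one_ne_zero (hmon.coeff_natDegree.symm.trans this)
  · simp only [Matrix.mulVec, dotProduct, toeplitzMat, Matrix.of_apply, Pi.zero_apply, h.2,
      Finset.sum_mul]
    rw [Finset.sum_comm]
    refine Finset.sum_eq_zero fun μ hμ => ?_
    have hz := ne_zero_of_norm_eq_one (h.1 μ hμ).1
    have he : ∑ j : Fin n, p.coeff j * μ ^ (j : ℕ) = 0 := by
      rw [Fin.sum_univ_eq_sum_range (fun j => p.coeff j * μ ^ j) n,
        ← Polynomial.eval_eq_sum_range' (hdeg ▸ hn), Polynomial.eval_prod]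
      exact Finset.prod_eq_zero hμ (by simp)
    calc _ = ∑ j : Fin n, (w μ * μ ^ (-(i : ℤ))) * (p.coeff j * μ ^ (j : ℕ)) := by
          refine Finset.sum_congr rfl fun j _ => ?_
          rw [sub_eq_add_neg, zpow_add₀ hz, zpow_natCast]
          ring
      _ = 0 := by rw [← Finset.mul_sum, he, mul_zero]

theorem mem_seqOfOrder (h : IsAtomic s S w) : s ∈ seqOfOrder S.card := by
  refine ⟨h.isHermitianSeq, fun k hk => ?_, fun k hk => ?_⟩
  · have := (h.posDef_of_le_card (n := k + 1) hk).det_pos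
    rw [toeplitzMat_succ, ← toeplitzDet_eq h.isHermitianSeq] at this
    exact_mod_cast this
  · rw [toeplitzDet, ← toeplitzMat_succ, h.det_eq_zero (by omega), Complex.zero_re]

end IsAtomic

theorem order_unique {s : ℤ → ℂ} {m n : ℕ} (hm : s ∈ seqOfOrder m) (hn : s ∈ seqOfOrder n) :
    m = n := by
  rcases lt_trichotomy m n with h | h | h
  · exact absurd (hm.2.2 m le_rfl) (hn.2.1 m h).ne'
  · exact h
  · exact absurd (hn.2.2 n le_rfl) (hm.2.1 n h).ne'

/-! ### Spectral decomposition of isometries in finite dimension -/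

section Isometry

variable {E : Type*} [NormedAddCommGroup E] [InnerProductSpace ℂ E]

theorem inner_pow_apply {U : E →ₗ[ℂ] E} (hU : ∀ x y, ⟪U x, U y⟫_ℂ = ⟪x, y⟫_ℂ) (k : ℕ) (x y : E) :
    ⟪(U ^ k) x, (U ^ k) y⟫_ℂ = ⟪x, y⟫_ℂ := by
  induction k with
  | zero => simp
  | succ k ih => rw [pow_succ', Module.End.mul_apply, Module.End.mul_apply, hU, ih]

theorem injective_of_inner {U : E →ₗ[ℂ] E} (hU : ∀ x y, ⟪U x, U y⟫_ℂ = ⟪x, y⟫_ℂ) :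
    Function.Injective U := by
  rw [injective_iff_map_eq_zero]
  intro x hx
  have := hU x x
  rw [hx, inner_zero_left] at this
  exact inner_self_eq_zero.mp this.symm

variable [FiniteDimensional ℂ E]

/-- By dimension, an isometry maps an invariant subspace onto itself, so the orthogonal complement
is invariant as well. -/
theorem isSemisimple_of_inner {U : Module.End ℂ E} (hU : ∀ x y, ⟪U x, U y⟫_ℂ = ⟪x, y⟫_ℂ) :
    U.IsSemisimple := by
  rw [Module.End.isSemisimple_iff]
  intro p hp
  refine ⟨pᗮ, fun x hx => ?_, Submodule.isCompl_orthogonal p⟩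
  have hmap : p.map U = p := by
    refine Submodule.eq_of_le_of_finrank_eq (Submodule.map_le_iff_le_comap.mpr hp) ?_
    exact (Submodule.equivMapOfInjective U (injective_of_inner hU) p).finrank_eq.symm
  rw [Submodule.mem_comap, Submodule.mem_orthogonal]
  intro y hy
  rw [← hmap] at hy
  obtain ⟨z, hz, rfl⟩ := hy
  rw [hU]
  exact (Submodule.mem_orthogonal _ _).mp hx z hz

/-- Spectral decomposition of a vector for a unitary operator in finite dimension. -/
theorem exists_eigenvector_decomposition {U : Module.End ℂ E}
    (hU : ∀ x y, ⟪U x, U y⟫_ℂ = ⟪x, y⟫_ℂ) (x : E) :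
    ∃ f : ℂ →₀ E, (∀ μ, U (f μ) = μ • f μ) ∧ ∑ μ ∈ f.support, f μ = x := by
  have hss := (isSemisimple_of_inner hU).isFinitelySemisimple
  have htop := Module.End.iSup_maxGenEigenspace_eq_top U
  simp_rw [hss.maxGenEigenspace_eq_eigenspace] at htop
  obtain ⟨f, hf, hx⟩ := (Submodule.mem_iSup_iff_exists_finsupp _ x).mp (htop ▸ Submodule.mem_top)
  exact ⟨f, fun μ => Module.End.mem_eigenspace_iff.mp (hf μ), hx⟩

/-- The correlation sequence of a unitary operator in finite dimension is atomic. -/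
theorem isAtomic_of_inner_pow {U : Module.End ℂ E} (hU : ∀ x y, ⟪U x, U y⟫_ℂ = ⟪x, y⟫_ℂ) {e : E}
    {s : ℤ → ℂ} (hs : IsHermitianSeq s) (h : ∀ k : ℕ, s k = ⟪e, (U ^ k) e⟫_ℂ) :
    ∃ S w, IsAtomic s S w := by
  obtain ⟨f, hf, rfl⟩ := exists_eigenvector_decomposition hU e
  -- Nonorthogonal components satisfy `conj μ * ν = 1`. For `μ = ν` this puts the eigenvalues on the
  -- unit circle; then components for distinct eigenvalues are orthogonal.
  have hinner : ∀ μ ν : ℂ, conj μ * ν * ⟪f μ, f ν⟫_ℂ = ⟪f μ, f ν⟫_ℂ := fun μ ν => by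
    conv_rhs => rw [← hU, hf, hf, inner_smul_left, inner_smul_right]
    ring
  have hnorm : ∀ μ ∈ f.support, ‖μ‖ = 1 := fun μ hμ => by
    have h1 := hinner μ μ
    have h2 : ⟪f μ, f μ⟫_ℂ ≠ 0 := inner_self_ne_zero.mpr (Finsupp.mem_support_iff.mp hμ)
    have h3 := mul_right_cancel₀ h2 (h1.trans (one_mul _).symm)
    rw [← Complex.normSq_eq_conj_mul_self, Complex.normSq_eq_norm_sq] at h3
    have h4 : ‖μ‖ ^ 2 = 1 := by exact_mod_cast h3
    exact (pow_eq_one_iff_of_nonneg (norm_nonneg μ) two_ne_zero).mp h4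
  have horth : ∀ μ ∈ f.support, ∀ ν, ν ≠ μ → ⟪f μ, f ν⟫_ℂ = 0 := fun μ hμ ν hne => by
    by_contra h0
    have h3 := mul_right_cancel₀ h0 ((hinner μ ν).trans (one_mul _).symm)
    rw [← Complex.inv_eq_conj (hnorm μ hμ)] at h3
    exact hne (((inv_mul_eq_one₀ (ne_zero_of_norm_eq_one (hnorm μ hμ))).mp h3).symm)
  have hpow : ∀ (k : ℕ) μ, (U ^ k) (f μ) = μ ^ k • f μ := fun k μ => by
    induction k with
    | zero => simp
    | succ k ih => rw [pow_succ', Module.End.mul_apply, ih, map_smul, hf, smul_smul, pow_succ]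
  have hnat : ∀ k : ℕ, s k = ∑ μ ∈ f.support, ((‖f μ‖ ^ 2 : ℝ) : ℂ) * μ ^ k := fun k => by
    rw [h, sum_inner]
    refine Finset.sum_congr rfl fun μ hμ => ?_
    rw [map_sum, inner_sum, Finset.sum_eq_single μ]
    · rw [hpow, inner_smul_right, inner_self_eq_norm_sq_to_K]
      push_cast
      exact mul_comm _ _
    · intro ν _ hne
      rw [hpow, inner_smul_right, horth μ hμ ν hne, mul_zero]
    · exact fun h => absurd hμ h
  refine ⟨f.support, fun μ => ‖f μ‖ ^ 2, fun μ hμ => ⟨hnorm μ hμ, ?_⟩, fun k => ?_⟩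
  · have := Finsupp.mem_support_iff.mp hμ
    positivity
  · obtain ⟨m, rfl | rfl⟩ := k.eq_nat_or_neg
    · simpa using hnat m
    · rw [hs, hnat, map_sum]
      refine Finset.sum_congr rfl fun μ hμ => ?_
      rw [map_mul, Complex.conj_ofReal, ← conj_zpow_of_norm_eq_one (hnorm μ hμ), zpow_natCast]

end Isometry

end FuzzyCircle

/-! ### Carathéodory's theorem for sequences of finite order -/

namespace FuzzyCircle

open scoped ComplexOrder MatrixOrder ComplexConjugate InnerProductSpace Matrix

/-- A positive semidefinite matrix is a Gram matrix. -/
theorem exists_gram {n : ℕ} {M : Matrix (Fin n) (Fin n) ℂ} (hM : M.PosSemidef) :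
    ∃ c : Fin n → EuclideanSpace ℂ (Fin n), ∀ i j, ⟪c i, c j⟫_ℂ = M i j := by
  obtain ⟨B, hB⟩ := CStarAlgebra.nonneg_iff_eq_star_mul_self.mp hM.nonneg
  refine ⟨fun j => WithLp.toLp 2 (fun l => B l j), fun i j => ?_⟩
  rw [hB, PiLp.inner_apply, Matrix.mul_apply]
  refine Finset.sum_congr rfl fun l _ => ?_
  simp [Matrix.star_apply, mul_comm]

/-- A singular Toeplitz matrix with positive definite leading block is the Gram matrix of an
initial piece of the orbit of a cyclic vector of a unitary operator. -/
theorem exists_isometry {s : ℤ → ℂ} (hs : IsHermitianSeq s) {n : ℕ}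
    (hpd : (toeplitzMat s n).PosDef) (hdet : (toeplitzMat s (n + 1)).det = 0) :
    ∃ (U : Module.End ℂ (EuclideanSpace ℂ (Fin n))) (e : EuclideanSpace ℂ (Fin n)),
      (∀ x y, ⟪U x, U y⟫_ℂ = ⟪x, y⟫_ℂ) ∧ LinearIndependent ℂ (fun i : Fin n => (U ^ (i : ℕ)) e) ∧
      ∀ k ≤ n, s (k : ℕ) = ⟪e, (U ^ k) e⟫_ℂ := by
  obtain ⟨c, hc⟩ := exists_gram hpd.posSemidef
  have hker : ∀ g : Fin n → ℂ, (∀ i : Fin n, ∑ j : Fin n, s ((j : ℤ) - i) * g j = 0) → g = 0 := by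
    intro g hg
    by_contra hne
    exact hpd.det_pos.ne' (Matrix.exists_mulVec_eq_zero_iff.mp ⟨g, hne, funext fun i => hg i⟩)
  have hli : LinearIndependent ℂ c := by
    rw [Fintype.linearIndependent_iff]
    intro g hg i
    refine congrFun (hker g fun i => ?_) i
    have := congrArg (fun z => ⟪c i, z⟫_ℂ) hg
    simp only [inner_sum, inner_smul_right, hc, inner_zero_right] at this
    rw [← this]
    exact Finset.sum_congr rfl fun j _ => mul_comm _ _
  let b := basisOfLinearIndependentOfCardEqFinrank' c hli (by simp)
  have hb : ∀ j, b j = c j := fun j => by simp [b]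
  -- The last entry of this null vector cannot vanish, as the leading block is nonsingular. So the
  -- last column is the combination of the others with coefficients `y`.
  obtain ⟨v, hv0, hv⟩ := Matrix.exists_mulVec_eq_zero_iff.mpr hdet
  have hrow : ∀ i : Fin (n + 1),
      ∑ j : Fin n, s ((j : ℤ) - i) * v j.castSucc + s ((n : ℤ) - i) * v (Fin.last n) = 0 := by
    intro i
    have := congrFun hv i
    simpa [Matrix.mulVec, dotProduct, toeplitzMat, Fin.sum_univ_castSucc] using this
  have hlast : v (Fin.last n) ≠ 0 := fun h0 => by
    refine hv0 (funext fun j => ?_)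
    have h1 := hker (fun j => v j.castSucc) fun i => by
      have := hrow i.castSucc
      rwa [h0, mul_zero, add_zero] at this
    refine Fin.lastCases h0 (fun j => congrFun h1 j) j
  let y : Fin n → ℂ := fun j => -(v j.castSucc / v (Fin.last n))
  have hy : ∀ i : Fin (n + 1), ∑ j : Fin n, y j * s ((j : ℤ) - i) = s ((n : ℤ) - i) := fun i => by
    have h1 := hrow i
    have h2 : ∑ j : Fin n, y j * s ((j : ℤ) - i) =
        -(∑ j : Fin n, s ((j : ℤ) - i) * v j.castSucc) / v (Fin.last n) := by
      rw [neg_div, Finset.sum_div, ← Finset.sum_neg_distrib]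
      exact Finset.sum_congr rfl fun j _ => by simp only [y]; ring
    rw [h2, div_eq_iff hlast]
    linear_combination -h1
  -- Vectors whose Gram matrix is the full singular Toeplitz matrix; `y` gives the last one inside
  -- the `n`-dimensional space.
  let d : Fin (n + 1) → EuclideanSpace ℂ (Fin n) := Fin.lastCases (∑ j, y j • c j) c
  have hdc : ∀ j, d j.castSucc = c j := fun j => Fin.lastCases_castSucc ..
  have hdl : d (Fin.last n) = ∑ j, y j • c j := Fin.lastCases_last ..
  have h1 : ∀ i j : Fin n, ⟪d i.castSucc, d j.castSucc⟫_ℂ = s ((j : ℤ) - i) := fun i j => by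
    rw [hdc, hdc, hc]
    rfl
  have h2 : ∀ i : Fin n, ⟪d i.castSucc, d (Fin.last n)⟫_ℂ = s ((n : ℤ) - i) := fun i => by
    rw [hdl, inner_sum]
    refine Eq.trans ?_ (hy i.castSucc)
    refine Finset.sum_congr rfl fun j _ => ?_
    rw [inner_smul_right, ← hdc j, h1]
    rfl
  have h3 : ∀ j : Fin n, ⟪d (Fin.last n), d j.castSucc⟫_ℂ = s ((j : ℤ) - n) := fun j => by
    rw [← inner_conj_symm, h2, ← hs, neg_sub]
  have hgram : ∀ i j : Fin (n + 1), ⟪d i, d j⟫_ℂ = s ((j : ℤ) - i) := by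
    intro i j
    induction i using Fin.lastCases with
    | cast i =>
      induction j using Fin.lastCases with
      | cast j => exact h1 i j
      | last => exact h2 i
    | last =>
      induction j using Fin.lastCases with
      | cast j => exact h3 j
      | last =>
        nth_rewrite 2 [hdl]
        rw [inner_sum, Fin.val_last]
        refine Eq.trans ?_ (hy (Fin.last n))
        refine Finset.sum_congr rfl fun j _ => ?_
        rw [inner_smul_right, ← hdc j, h3]
        rfl
  -- The shift along `d`. It is isometric since Toeplitz entries depend only on `j - i`.
  let U : Module.End ℂ (EuclideanSpace ℂ (Fin n)) := b.constr ℂ (fun j => d j.succ)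
  have hUd : ∀ j : Fin n, U (d j.castSucc) = d j.succ := fun j => by
    rw [hdc, ← hb]
    exact b.constr_basis ℂ _ j
  have hUb : ∀ i j : Fin n, ⟪U (b i), U (b j)⟫_ℂ = ⟪b i, b j⟫_ℂ := fun i j => by
    rw [hb, hb, ← hdc, ← hdc, hUd, hUd, hgram, hgram]
    congr 1
    simp
  have hU : ∀ x y, ⟪U x, U y⟫_ℂ = ⟪x, y⟫_ℂ := fun x y => by
    rw [← b.sum_repr x, ← b.sum_repr y]
    simp only [map_sum, map_smul, sum_inner, inner_sum, inner_smul_left, inner_smul_right, hUb]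
  have hpow : ∀ (k : ℕ) (hk : k < n + 1), (U ^ k) (d 0) = d ⟨k, hk⟩ := by
    intro k
    induction k with
    | zero => exact fun _ => rfl
    | succ k ih =>
      intro hk
      rw [pow_succ', Module.End.mul_apply, ih (by omega)]
      exact hUd ⟨k, by omega⟩
  refine ⟨U, d 0, hU, ?_, fun k hk => ?_⟩
  · convert hli using 2 with i
    rw [hpow i (by omega), ← hdc]
    rfl
  · rw [hpow k (by omega), hgram]
    simp

section Extension

variable {n : ℕ} {E : Type*} [NormedAddCommGroup E] [InnerProductSpace ℂ E]

/-- The entries of the Gram matrix of the orbit of `e`. -/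
theorem inner_pow_pow {U : Module.End ℂ E} (hU : ∀ x y, ⟪U x, U y⟫_ℂ = ⟪x, y⟫_ℂ) {e : E}
    {s : ℤ → ℂ} (hs : IsHermitianSeq s) {m : ℕ} (h : ∀ k < m, s (k : ℕ) = ⟪e, (U ^ k) e⟫_ℂ)
    {i j : ℕ} (h1 : i < j + m) (h2 : j < i + m) :
    ⟪(U ^ i) e, (U ^ j) e⟫_ℂ = s ((j : ℤ) - i) := by
  rcases le_total i j with hij | hij
  · obtain ⟨k, rfl⟩ := Nat.exists_eq_add_of_le hij
    rw [pow_add, Module.End.mul_apply, inner_pow_apply hU, ← h k (by omega)]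
    congr 1
    push_cast
    ring
  · obtain ⟨k, rfl⟩ := Nat.exists_eq_add_of_le hij
    rw [pow_add, Module.End.mul_apply, inner_pow_apply hU, ← inner_conj_symm, ← h k (by omega),
      ← hs]
    congr 1
    push_cast
    ring

variable [FiniteDimensional ℂ E]

/-- Two Hermitian sequences with the same beginning, one of finite order: the determinants
see the first difference. -/
theorem det_ne_zero_of_first_difference {U : Module.End ℂ E}
    (hU : ∀ x y, ⟪U x, U y⟫_ℂ = ⟪x, y⟫_ℂ) {e : E} (hdim : Module.finrank ℂ E = n)
    (hli : LinearIndependent ℂ (fun i : Fin n => (U ^ (i : ℕ)) e))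
    {s : ℤ → ℂ} (hs : IsHermitianSeq s) {r : ℕ}
    (h : ∀ k < n + r, s (k : ℕ) = ⟪e, (U ^ k) e⟫_ℂ)
    (hne : s ((n + r : ℕ) : ℤ) ≠ ⟪e, (U ^ (n + r)) e⟫_ℂ) :
    (toeplitzMat s (n + 2 * r)).det ≠ 0 := by
  obtain ⟨N, hN⟩ : ∃ N, N = n + 2 * r := ⟨_, rfl⟩
  rw [← hN]
  intro hdet
  obtain ⟨x, hx0, hx⟩ := Matrix.exists_mulVec_eq_zero_iff.mpr hdet
  have hpowinj : ∀ k : ℕ, Function.Injective (U ^ k) := fun k =>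
    injective_of_inner (inner_pow_apply hU k)
  have hspan : Submodule.span ℂ (Set.range fun i : Fin n => (U ^ (i : ℕ)) e) = ⊤ :=
    hli.span_eq_top_of_card_eq_finrank' (by simp [hdim])
  let X : ℕ → ℂ := fun j => if hj : j < N then x ⟨j, hj⟩ else 0
  let u : ℕ → E := fun j => (U ^ j) e
  let Y : E := ∑ j ∈ Finset.range N, X j • u j
  -- The deviation of the Toeplitz matrix from the Gram matrix of the orbit. It vanishes for `|i -
  -- j| < n + r`; at size `n + 2r` only two triangular `r × r` corners remain, with nonzero constant
  -- diagonals.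
  let ε : ℕ → ℕ → ℂ := fun i j => s ((j : ℤ) - i) - ⟪u i, u j⟫_ℂ
  have hε : ∀ i j, i < j + (n + r) → j < i + (n + r) → ε i j = 0 := fun i j h1 h2 =>
    sub_eq_zero.mpr (inner_pow_pow hU hs h h1 h2).symm
  have hrow : ∀ i < N, ∑ j ∈ Finset.range N, ε i j * X j + ⟪u i, Y⟫_ℂ = 0 := by
    intro i hi
    have h1 := congrFun hx ⟨i, hi⟩
    have h2 : ∑ j ∈ Finset.range N, s ((j : ℤ) - i) * X j = 0 := by
      rw [← Fin.sum_univ_eq_sum_range (fun j : ℕ => s ((j : ℤ) - i) * X j)]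
      refine Eq.trans (Finset.sum_congr rfl fun j _ => ?_) h1
      simp [toeplitzMat, X]
    simp only [Y, inner_sum, inner_smul_right]
    rw [← Finset.sum_add_distrib, ← h2]
    exact Finset.sum_congr rfl fun j _ => by simp only [ε]; ring
  -- The middle `n` rows do not meet the corners, so `Y` is orthogonal to the vectors `U^r (U^i e)`
  -- with `i < n`, which span the space.
  have hY : Y = 0 := by
    have hsurj : Function.Surjective (U ^ r) := LinearMap.surjective_of_injective (hpowinj r)
    obtain ⟨Z, hZ⟩ := hsurj Y
    have hZ0 : Z = 0 := by
      have : ∀ z ∈ Submodule.span ℂ (Set.range fun i : Fin n => (U ^ (i : ℕ)) e),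
          ⟪z, Z⟫_ℂ = 0 := by
        intro z hz
        induction hz using Submodule.span_induction with
        | mem z hz =>
          obtain ⟨i, rfl⟩ := hz
          have h1 := hrow (r + i) (by omega)
          rw [Finset.sum_eq_zero (fun j hj => ?_), zero_add, ← hZ] at h1
          · simp only [u] at h1
            rwa [pow_add, Module.End.mul_apply, inner_pow_apply hU] at h1
          · rw [Finset.mem_range] at hj
            rw [hε _ _ (by omega) (by omega), zero_mul]
        | zero => exact inner_zero_left _
        | add a b _ _ ha hb => rw [inner_add_left, ha, hb, add_zero]
        | smul a b _ hb => rw [inner_smul_left, hb, mul_zero]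
      exact inner_self_eq_zero.mp (this Z (hspan ▸ Submodule.mem_top))
    rw [← hZ, hZ0, map_zero]
  have hrow' : ∀ i < N, ∑ j ∈ Finset.range N, ε i j * X j = 0 := fun i hi => by
    have := hrow i hi
    rwa [hY, inner_zero_right, add_zero] at this
  have hcorner : ∀ i, ε i (n + r + i) ≠ 0 := fun i => by
    have h1 : ⟪u i, u (n + r + i)⟫_ℂ = ⟪e, (U ^ (n + r)) e⟫_ℂ := by
      simp only [u]
      rw [add_comm (n + r) i, pow_add U i, Module.End.mul_apply, inner_pow_apply hU]
    have h2 : (((n + r + i : ℕ) : ℤ) - i) = ((n + r : ℕ) : ℤ) := by push_cast; ring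
    simp only [ε]
    rw [h1, h2]
    exact sub_ne_zero.mpr hne
  have hcorner' : ∀ i, ε (n + r + i) i ≠ 0 := fun i => by
    have : ε (n + r + i) i = conj (ε i (n + r + i)) := by
      simp only [ε]
      rw [map_sub, inner_conj_symm, ← hs, neg_sub]
    rw [this]
    exact (map_ne_zero _).mpr (hcorner i)
  -- Substitution in the upper right triangular corner, starting from the last unknown. The lower
  -- left corner is treated likewise from the first unknown, and linear independence disposes of the
  -- `n` middle ones.
  have hhigh : ∀ k i, i + k + 1 = r → X (n + r + i) = 0 := by
    intro k
    induction k using Nat.strong_induction_on with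
    | _ k ih =>
      intro i hi
      have h1 := hrow' i (by omega)
      rw [Finset.sum_eq_single (n + r + i)] at h1
      · exact (mul_eq_zero.mp h1).resolve_left (hcorner i)
      · intro j hj hne'
        rw [Finset.mem_range] at hj
        rcases lt_or_gt_of_ne hne' with hlt | hgt
        · rw [hε _ _ (by omega) (by omega), zero_mul]
        · have := ih (n + r + i + k - j) (by omega) (j - (n + r)) (by omega)
          rw [show n + r + (j - (n + r)) = j by omega] at this
          rw [this, mul_zero]
      · intro hn
        exact absurd (Finset.mem_range.mpr (by omega)) hn
  have hlow : ∀ i, i < r → X i = 0 := by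
    intro i
    induction i using Nat.strong_induction_on with
    | _ i ih =>
      intro hi
      have h1 := hrow' (n + r + i) (by omega)
      rw [Finset.sum_eq_single i] at h1
      · exact (mul_eq_zero.mp h1).resolve_left (hcorner' i)
      · intro j hj hne'
        rw [Finset.mem_range] at hj
        rcases lt_or_gt_of_ne hne' with hlt | hgt
        · rw [ih j hlt (by omega), mul_zero]
        · rw [hε _ _ (by omega) (by omega), zero_mul]
      · intro hn
        exact absurd (Finset.mem_range.mpr (by omega)) hn
  have hmid : ∀ i : Fin n, X (r + i) = 0 := by
    refine Fintype.linearIndependent_iff.mp hli (fun i => X (r + i)) ?_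
    apply hpowinj r
    rw [map_zero, map_sum, ← hY]
    simp only [Y]
    have hsub : Finset.Ico r (r + n) ⊆ Finset.range N := fun j hj => by
      rw [Finset.mem_Ico] at hj
      exact Finset.mem_range.mpr (by omega)
    rw [← Finset.sum_subset hsub, Finset.sum_Ico_eq_sum_range, Nat.add_sub_cancel_left,
      ← Fin.sum_univ_eq_sum_range (fun i => X (r + i) • u (r + i))]
    · refine Finset.sum_congr rfl fun i _ => ?_
      rw [map_smul, ← Module.End.mul_apply, ← pow_add]
    · intro j hj hj'
      rw [Finset.mem_range] at hj
      rw [Finset.mem_Ico] at hj'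
      rcases lt_or_ge j r with hlt | hge
      · rw [hlow j hlt, zero_smul]
      · have := hhigh (N - 1 - j) (j - (n + r)) (by omega)
        rw [show n + r + (j - (n + r)) = j by omega] at this
        rw [this, zero_smul]
  refine hx0 (funext fun j => ?_)
  have hXj : x j = X j := by simp [X]
  rw [hXj, Pi.zero_apply]
  rcases lt_or_ge (j : ℕ) r with hlt | hge
  · exact hlow j hlt
  · rcases lt_or_ge (j : ℕ) (r + n) with hlt' | hge'
    · have := hmid ⟨j - r, by omega⟩
      rwa [show r + ((j : ℕ) - r) = j by omega] at this
    · have := hhigh (N - 1 - j) (j - (n + r)) (by omega)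
      rwa [show n + r + ((j : ℕ) - (n + r)) = j by omega] at this

end Extension

/-- Sequences of finite order are moment sequences of measures with finite support. -/
theorem exists_isAtomic {s : ℤ → ℂ} {n : ℕ} (hs : s ∈ seqOfOrder n) :
    ∃ S w, IsAtomic s S w ∧ S.card = n := by
  obtain ⟨hH, hpos, hzero⟩ := hs
  have hdet : ∀ N, n < N → (toeplitzMat s N).det = 0 := fun N hN => by
    obtain ⟨k, rfl⟩ : ∃ k, N = k + 1 := ⟨N - 1, by omega⟩
    rw [toeplitzMat_succ, ← toeplitzDet_eq hH, hzero k (by omega), Complex.ofReal_zero]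
  obtain ⟨U, e, hU, hli, hse⟩ :=
    exists_isometry hH (posDef_toeplitzMat hH hpos) (hdet (n + 1) (by omega))
  -- If `s` first left the orbit at the index `n + r + 1`, the determinant of size `n + 2(r + 1)`
  -- would be nonzero, although `D_k = 0` for all `k ≥ n`.
  have hall : ∀ k : ℕ, s k = ⟪e, (U ^ k) e⟫_ℂ := by
    intro k
    induction k using Nat.strong_induction_on with
    | _ k ih =>
      rcases le_or_gt k n with hk | hk
      · exact hse k hk
      · obtain ⟨r, rfl⟩ := Nat.exists_eq_add_of_lt hk
        by_contra hne
        exact det_ne_zero_of_first_difference hU (by simp) hli hH (r := r + 1)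
          (fun k hk => ih k (by omega)) hne (hdet _ (by omega))
  obtain ⟨S, w, h⟩ := isAtomic_of_inner_pow hU hH hall
  exact ⟨S, w, h, order_unique h.mem_seqOfOrder ⟨hH, hpos, hzero⟩⟩

/-- For finite order, semidefiniteness cannot be read off from the leading minors directly; it comes
from the atomic representation. -/
theorem posToeplitz_iff_mem_seqV {s : ℤ → ℂ} : PosToeplitz s ↔ s ∈ seqV := by
  refine ⟨PosToeplitz.mem_seqV, ?_⟩
  rintro (h | h)
  · obtain ⟨n, hn⟩ := Set.mem_iUnion.mp h
    obtain ⟨S, w, h, -⟩ := exists_isAtomic hn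
    exact h.posToeplitz
  · exact fun n => (posDef_toeplitzMat h.1 fun k _ => h.2 k).posSemidef

end FuzzyCircle

/-! ### Power series on the disk, Fourier coefficients and the Poisson integral -/

namespace FuzzyCircle

open scoped ComplexConjugate Topology

/-- `∑ a_k z^k` converges to `g z` on the open unit disk. -/
def HasDiskSeries (a : ℕ → ℂ) (g : ℂ → ℂ) : Prop :=
  ∀ z : ℂ, ‖z‖ < 1 → HasSum (fun k => a k * z ^ k) (g z)

namespace HasDiskSeries

variable {a b : ℕ → ℂ} {g : ℂ → ℂ}

theorem hasFPowerSeriesOnBall (h : HasDiskSeries a g) :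
    HasFPowerSeriesOnBall g (FormalMultilinearSeries.ofScalars ℂ a) 0 1 := by
  refine ⟨?_, zero_lt_one, fun {y} hy => ?_⟩
  · refine ENNReal.le_of_forall_nnreal_lt fun r hr => ?_
    refine FormalMultilinearSeries.le_radius_of_tendsto _ (l := 0) ?_
    have hr' : (r : ℝ) < 1 := by exact_mod_cast hr
    have := (h (r : ℂ) (by simpa using hr')).summable.tendsto_atTop_zero.norm
    simpa [FormalMultilinearSeries.ofScalars_norm] using this
  · have hy' : ‖y‖ < 1 := by
      rw [← ENNReal.ofReal_one, Metric.eball_ofReal] at hy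
      simpa using hy
    simpa [FormalMultilinearSeries.ofScalars_apply_eq, mul_comm] using h y hy'

theorem differentiableOn (h : HasDiskSeries a g) : DifferentiableOn ℂ g (Metric.ball 0 1) := by
  have := h.hasFPowerSeriesOnBall.differentiableOn
  rwa [← ENNReal.ofReal_one, Metric.eball_ofReal] at this

theorem eq_taylor (h : HasDiskSeries a g) (k : ℕ) : a k = iteratedDeriv k g 0 / k.factorial := by
  have h1 := h.hasFPowerSeriesOnBall.hasFPowerSeriesAt
  have h2 := h1.analyticAt.hasFPowerSeriesAt
  have := congrArg (fun p : FormalMultilinearSeries ℂ ℂ ℂ => p.coeff k)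
    (h1.eq_formalMultilinearSeries h2)
  simpa [FormalMultilinearSeries.coeff_ofScalars] using this

theorem unique (h : HasDiskSeries a g) (h' : HasDiskSeries b g) : a = b :=
  funext fun k => (h.eq_taylor k).trans (h'.eq_taylor k).symm

theorem apply_zero (h : HasDiskSeries a g) : a 0 = g 0 := by
  have := h.eq_taylor 0
  simpa using this

theorem congr {g' : ℂ → ℂ} (h : HasDiskSeries a g) (hg : ∀ z, ‖z‖ < 1 → g z = g' z) :
    HasDiskSeries a g' := fun z hz => hg z hz ▸ h z hz

end HasDiskSeries

theorem hasDiskSeries_of_differentiableOn {g : ℂ → ℂ}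
    (hg : DifferentiableOn ℂ g (Metric.ball 0 1)) :
    HasDiskSeries (fun k => iteratedDeriv k g 0 / k.factorial) g := by
  intro z hz
  have := Complex.hasSum_taylorSeries_on_ball hg (z := z) (by simpa using hz)
  refine this.congr_fun fun k => ?_
  simp only [sub_zero, smul_eq_mul]
  ring

/-- Fourier coefficients `∫ g(t) e^{ikt} dt/2π` of a real function. -/
noncomputable def fcoef (g : S1 → ℝ) (k : ℤ) : ℂ := ∫ t : S1, (g t : ℂ) * fourier k t ∂arcMeasure

theorem coeff_eq_fcoef (f : L1) (k : ℤ) : coeff f k = fcoef f k := rfl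

theorem norm_fourier_apply (k : ℤ) (t : S1) : ‖(fourier k t : ℂ)‖ = 1 := Circle.norm_coe _

theorem integrable_mul_fourier {g : S1 → ℝ} (hg : Integrable g arcMeasure) (k : ℤ) :
    Integrable (fun t => (g t : ℂ) * fourier k t) arcMeasure :=
  hg.ofReal.mul_bdd (fourier k).continuous.aestronglyMeasurable
    (ae_of_all _ fun t => (norm_fourier_apply k t).le)

theorem norm_fcoef_le (g : S1 → ℝ) (k : ℤ) : ‖fcoef g k‖ ≤ ∫ t, |g t| ∂arcMeasure := by
  refine (norm_integral_le_integral_norm _).trans_eq (integral_congr_ae (ae_of_all _ fun t => ?_))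
  simp only [norm_mul, norm_fourier_apply, mul_one, Complex.norm_real, Real.norm_eq_abs]

theorem fcoef_zero (g : S1 → ℝ) : fcoef g 0 = ((∫ t, g t ∂arcMeasure : ℝ) : ℂ) := by
  simp only [fcoef, fourier_zero, mul_one]
  exact integral_ofReal

theorem fcoef_neg (g : S1 → ℝ) (k : ℤ) : fcoef g (-k) = conj (fcoef g k) := by
  simp only [fcoef]
  rw [← integral_conj]
  refine integral_congr_ae (ae_of_all _ fun t => ?_)
  simp

theorem fcoef_congr {g g' : S1 → ℝ} (h : g =ᵐ[arcMeasure] g') : fcoef g = fcoef g' :=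
  funext fun _ => integral_congr_ae (h.mono fun t ht => by simp only [ht])

theorem integral_fourier (k : ℤ) : ∫ t : S1, (fourier k t : ℂ) ∂arcMeasure =
    if k = 0 then 1 else 0 := by
  have h := congrFun (fourierCoeff_fourier (T := 2 * Real.pi) k) 0
  simp only [fourierCoeff, neg_zero, fourier_zero, one_smul] at h
  rw [h, Pi.single_apply]
  simp [eq_comm]

theorem fcoef_sub {g g' : S1 → ℝ} (hg : Integrable g arcMeasure) (hg' : Integrable g' arcMeasure)
    (k : ℤ) : fcoef (fun t => g t - g' t) k = fcoef g k - fcoef g' k := by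
  simp only [fcoef]
  rw [← integral_sub (integrable_mul_fourier hg k) (integrable_mul_fourier hg' k)]
  refine integral_congr_ae (ae_of_all _ fun t => ?_)
  push_cast
  ring

theorem fcoef_const (c : ℝ) (k : ℤ) : fcoef (fun _ => c) k = if k = 0 then (c : ℂ) else 0 := by
  simp only [fcoef]
  rw [integral_const_mul, integral_fourier]
  simp

theorem summable_coeff (g : S1 → ℝ) {z : ℂ} (hz : ‖z‖ < 1) :
    Summable (fun k : ℕ => fcoef g (k + 1) * z ^ (k + 1)) := by
  refine Summable.of_norm_bounded (g := fun k => (∫ t, |g t| ∂arcMeasure) * ‖z‖ ^ (k + 1))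
    (Summable.mul_left _ ?_) fun k => ?_
  · exact (summable_geometric_of_lt_one (norm_nonneg z) hz).comp_injective (add_left_injective 1)
  · rw [norm_mul, norm_pow]
    exact mul_le_mul_of_nonneg_right (norm_fcoef_le g _) (by positivity)

theorem hasSum_hardy (f : L1) {z : ℂ} (hz : ‖z‖ < 1) :
    HasSum (fun k : ℕ => coeff f (k + 1) * z ^ (k + 1)) (hardy f z) :=
  (summable_coeff f hz).hasSum

/-- A power series without constant term, as a full power series. -/
theorem hasDiskSeries_of_shift {a : ℕ → ℂ} {g : ℂ → ℂ} (c : ℂ)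
    (h : ∀ z : ℂ, ‖z‖ < 1 → HasSum (fun k : ℕ => a k * z ^ (k + 1)) (g z)) :
    HasDiskSeries (fun k => Nat.casesOn k c a) (fun z => c + g z) := by
  intro z hz
  rw [← hasSum_nat_add_iff' 1]
  simpa using h z hz

theorem HasDiskSeries.shift {a : ℕ → ℂ} {g : ℂ → ℂ} (h : HasDiskSeries a g) {z : ℂ} (hz : ‖z‖ < 1) :
    HasSum (fun k : ℕ => a (k + 1) * z ^ (k + 1)) (g z - a 0) := by
  simpa using (hasSum_nat_add_iff' 1).mpr (h z hz)

theorem hasDiskSeries_hardy (f : L1) :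
    HasDiskSeries (fun k => Nat.casesOn k 0 fun k => coeff f ((k : ℤ) + 1)) (hardy f) := by
  simpa using hasDiskSeries_of_shift 0 fun z hz => hasSum_hardy f hz

theorem hardy_zero (f : L1) : hardy f 0 = 0 := (hasDiskSeries_hardy f).apply_zero.symm

theorem expHardy_zero (f : L1) : expHardy f 0 = 1 := by simp [expHardy, hardy_zero]

theorem hasDiskSeries_expHardy (f : L1) : HasDiskSeries (taylorCoeff f) (expHardy f) := by
  refine hasDiskSeries_of_differentiableOn ?_
  exact ((hasDiskSeries_hardy f).differentiableOn.const_mul _).cexp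

theorem taylorCoeff_zero (f : L1) : taylorCoeff f 0 = 1 := by
  rw [(hasDiskSeries_expHardy f).apply_zero, expHardy_zero]

theorem nonlinear_zero (f : L1) : nonlinear f 0 = 2 * Complex.sin (Real.pi * coeff f 0) := rfl

theorem nonlinear_succ (f : L1) (k : ℕ) :
    nonlinear f ((k : ℤ) + 1) =
      Complex.I * Complex.exp (-(Complex.I * Real.pi * coeff f 0)) * taylorCoeff f (k + 1) := rfl

/-- The mean value `c₀`, as a real number. -/
noncomputable def mean (f : L1) : ℝ := ∫ t, f t ∂arcMeasure

theorem coeff_zero (f : L1) : coeff f 0 = mean f := fcoef_zero f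

theorem nonlinear_zero' (f : L1) : nonlinear f 0 = ((2 * Real.sin (Real.pi * mean f) : ℝ) : ℂ) := by
  rw [nonlinear_zero, coeff_zero]
  push_cast
  ring

theorem isHermitianSeq_nonlinear (f : L1) : IsHermitianSeq (nonlinear f) := by
  intro k
  rcases k with (_ | k) | k
  · change nonlinear f 0 = conj (nonlinear f 0)
    rw [nonlinear_zero', Complex.conj_ofReal]
  · rfl
  · change rescaledCoeff f (k + 1) = conj (conj (rescaledCoeff f (k + 1)))
    rw [Complex.conj_conj]

/-- The unit complex number `i e^{-iπc}`. -/
noncomputable def rotation (c : ℝ) : ℂ := Complex.I * Complex.exp (-(Complex.I * Real.pi * c))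

theorem rotation_ne_zero (c : ℝ) : rotation c ≠ 0 :=
  mul_ne_zero Complex.I_ne_zero (Complex.exp_ne_zero _)

/-- The real part is `s₀/2`, so that `rotation c + ∑ s_k z^k` has half the harmonic extension of `s`
as its real part. -/
theorem rotation_eq (c : ℝ) :
    rotation c =
        ((Real.sin (Real.pi * c) : ℝ) : ℂ) + ((Real.cos (Real.pi * c) : ℝ) : ℂ) * Complex.I := by
  rw [rotation, show -(Complex.I * Real.pi * c) = ((-(Real.pi * c) : ℝ) : ℂ) * Complex.I by
    push_cast; ring, Complex.exp_mul_I, ← Complex.ofReal_cos, ← Complex.ofReal_sin, Real.cos_neg,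
    Real.sin_neg]
  push_cast
  linear_combination (-Complex.sin (Real.pi * c)) * Complex.I_sq

/-- The defining relation solved for the series: `rotation c` is the inverse of `-i e^{iπc}`. -/
theorem hasSum_nonlinear (f : L1) {z : ℂ} (hz : ‖z‖ < 1) :
    HasSum (fun k : ℕ => nonlinear f ((k : ℤ) + 1) * z ^ (k + 1))
      (rotation (mean f) * (expHardy f z - 1)) := by
  have := ((hasDiskSeries_expHardy f).shift hz).mul_left (rotation (mean f))
  rw [taylorCoeff_zero] at this
  refine this.congr_fun fun k => ?_
  rw [nonlinear_succ, coeff_zero, rotation, mul_assoc]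

/-- Taylor coefficients are unique. Nonlinear coefficients are identified through this criterion
below. -/
theorem nonlinear_eq_of_hasSum {f : L1} {s : ℤ → ℂ} (hs : IsHermitianSeq s)
    (h0 : s 0 = ((2 * Real.sin (Real.pi * mean f) : ℝ) : ℂ))
    (h : ∀ z : ℂ, ‖z‖ < 1 → HasSum (fun k : ℕ => s ((k : ℤ) + 1) * z ^ (k + 1))
      (rotation (mean f) * (expHardy f z - 1))) : nonlinear f = s := by
  have hu := (hasDiskSeries_of_shift 0 fun z hz => hasSum_nonlinear f hz).unique
    (hasDiskSeries_of_shift 0 h)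
  have hnat : ∀ k : ℕ, nonlinear f k = s k := fun k => by
    cases k with
    | zero => exact (nonlinear_zero' f).trans h0.symm
    | succ k => exact_mod_cast congrFun hu (k + 1)
  funext k
  obtain ⟨m, rfl | rfl⟩ := k.eq_nat_or_neg
  · exact hnat m
  · rw [isHermitianSeq_nonlinear, hs, hnat]

/-- The Poisson integral of a nonnegative function is nonnegative. -/
theorem poisson_nonneg {g : S1 → ℝ} (hg : Integrable g arcMeasure) (h0 : 0 ≤ᵐ[arcMeasure] g)
    {z : ℂ} (hz : ‖z‖ < 1) :
    0 ≤ ∫ t, g t ∂arcMeasure + 2 * (∑' k : ℕ, fcoef g (k + 1) * z ^ (k + 1)).re := by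
  let w : S1 → ℂ := fun t => z * fourier 1 t
  have hw : ∀ t, ‖w t‖ < 1 := fun t => by
    simpa only [w, norm_mul, norm_fourier_apply, mul_one] using hz
  have hw1 : ∀ t, 1 - w t ≠ 0 := fun t h => by
    have h1 := hw t
    rw [← sub_eq_zero.mp h, norm_one] at h1
    exact lt_irrefl _ h1
  have hwc : Continuous w := continuous_const.mul (fourier 1).continuous
  have hpow : ∀ (k : ℕ) t, fourier ((k : ℤ) + 1) t * z ^ (k + 1) = w t ^ (k + 1) := fun k t => by
    have : ∀ m : ℕ, (fourier (m : ℤ) t : ℂ) = fourier 1 t ^ m := fun m => by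
      induction m with
      | zero => simp
      | succ m ih => rw [Nat.cast_succ, fourier_add, ih, pow_succ]
    have h1 := this (k + 1)
    push_cast at h1
    rw [h1, mul_pow, mul_comm]
  have hgeom : ∀ t, HasSum (fun k : ℕ => w t ^ (k + 1)) (w t / (1 - w t)) := fun t => by
    have := (hasSum_geometric_of_norm_lt_one (hw t)).mul_left (w t)
    refine (this.congr_fun fun k => ?_)
    exact pow_succ' _ _
  have hsum : HasSum (fun k : ℕ => fcoef g (k + 1) * z ^ (k + 1))
      (∫ t, (g t : ℂ) * (w t / (1 - w t)) ∂arcMeasure) := by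
    have hF := hasSum_integral_of_summable_integral_norm (μ := arcMeasure)
      (F := fun (k : ℕ) t => (g t : ℂ) * fourier ((k : ℤ) + 1) t * z ^ (k + 1))
      (fun k => (integrable_mul_fourier hg _).mul_const _) (by
        have : ∀ k : ℕ, ∫ t, ‖(g t : ℂ) * fourier ((k : ℤ) + 1) t * z ^ (k + 1)‖ ∂arcMeasure =
            (∫ t, |g t| ∂arcMeasure) * ‖z‖ ^ (k + 1) := fun k => by
          rw [← integral_mul_const]
          refine integral_congr_ae (ae_of_all _ fun t => ?_)
          simp only [norm_mul, norm_fourier_apply, mul_one, Complex.norm_real, Real.norm_eq_abs,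
            norm_pow]
        simp_rw [this]
        exact Summable.mul_left _
          ((summable_geometric_of_lt_one (norm_nonneg z) hz).comp_injective (add_left_injective 1)))
    have h1 : ∀ t, ∑' k : ℕ, (g t : ℂ) * fourier ((k : ℤ) + 1) t * z ^ (k + 1) =
        (g t : ℂ) * (w t / (1 - w t)) := fun t => by
      simp_rw [mul_assoc, hpow]
      exact ((hgeom t).mul_left _).tsum_eq
    simp_rw [h1, integral_mul_const] at hF
    exact hF
  rw [hsum.tsum_eq]
  have hint : Integrable (fun t => (g t : ℂ) * (w t / (1 - w t))) arcMeasure := by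
    refine hg.ofReal.mul_bdd (c := ‖z‖ / (1 - ‖z‖))
      (hwc.div (continuous_const.sub hwc) hw1).aestronglyMeasurable (ae_of_all _ fun t => ?_)
    have hwn : ‖w t‖ = ‖z‖ := by simp only [w, norm_mul, norm_fourier_apply, mul_one]
    rw [norm_div, hwn]
    have h2 : 1 - ‖z‖ ≤ ‖1 - w t‖ := by
      have := norm_sub_norm_le (1 : ℂ) (w t)
      rwa [norm_one, hwn] at this
    have h3 : 0 < 1 - ‖z‖ := by linarith
    gcongr
  have hre : (∫ t, (g t : ℂ) * (w t / (1 - w t)) ∂arcMeasure).re =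
      ∫ t, g t * (w t / (1 - w t)).re ∂arcMeasure := by
    have := integral_re hint
    simp only [RCLike.re_eq_complex_re, Complex.re_ofReal_mul] at this
    exact this.symm
  have hint' : Integrable (fun t => g t * (w t / (1 - w t)).re) arcMeasure := by
    have := hint.re
    simpa only [RCLike.re_eq_complex_re, Complex.re_ofReal_mul] using this
  rw [hre, ← integral_const_mul, ← integral_add hg (hint'.const_mul 2)]
  refine integral_nonneg_of_ae (h0.mono fun t ht => ?_)
  -- The Poisson kernel: `1 + 2w/(1-w) = (1+w)/(1-w)`, with real part `(1-|w|²)/|1-w|²`.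
  have hker : 0 ≤ 1 + 2 * (w t / (1 - w t)).re := by
    have h1 : (1 : ℝ) + 2 * (w t / (1 - w t)).re = ((1 + w t) / (1 - w t)).re := by
      have : (1 + w t) / (1 - w t) = 1 + 2 * (w t / (1 - w t)) := by
        field_simp [hw1 t]
        ring
      rw [this]
      simp
    rw [h1, Complex.div_re, ← add_div]
    refine div_nonneg ?_ (Complex.normSq_nonneg _)
    have h2 := (Complex.sq_norm (w t)) ▸ (pow_le_one₀ (norm_nonneg _) (hw t).le : ‖w t‖ ^ 2 ≤ 1)
    rw [Complex.normSq_apply] at h2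
    simp
    nlinarith
  have : g t + 2 * (g t * (w t / (1 - w t)).re) = g t * (1 + 2 * (w t / (1 - w t)).re) := by ring
  simp only [Pi.zero_apply]
  rw [this]
  exact mul_nonneg ht hker

theorem integrable_L1 (f : L1) : Integrable f arcMeasure := L1.integrable_coeFn f

/-- The harmonic extension of a fuzzy set has values in `[0, 1]`. -/
theorem harmonic_mem_Icc {f : L1} (hf : f ∈ fuzzySets) {z : ℂ} (hz : ‖z‖ < 1) :
    mean f + 2 * (hardy f z).re ∈ Set.Icc (0 : ℝ) 1 := by
  have hfi := integrable_L1 f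
  replace hf : ∀ᵐ t ∂arcMeasure, f t ∈ Set.Icc (0 : ℝ) 1 := hf
  refine ⟨poisson_nonneg hfi (hf.mono fun t ht => ht.1) hz, ?_⟩
  have h := poisson_nonneg (g := fun t => 1 - f t) ((integrable_const 1).sub hfi)
    (hf.mono fun t ht => sub_nonneg.mpr ht.2) hz
  have h1 : ∀ k : ℕ, fcoef (fun t => 1 - f t) ((k : ℤ) + 1) = -fcoef f (k + 1) := fun k => by
    rw [fcoef_sub (integrable_const 1) hfi, fcoef_const, if_neg (by omega), zero_sub]
  simp_rw [h1, neg_mul, tsum_neg] at h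
  rw [integral_sub (integrable_const 1) hfi] at h
  simp only [integral_const, probReal_univ, smul_eq_mul, mul_one, Complex.neg_re] at h
  have h2 : (∑' k : ℕ, fcoef f (k + 1) * z ^ (k + 1)).re = (hardy f z).re := rfl
  have h3 : ∫ t, f t ∂arcMeasure = mean f := rfl
  rw [h2, h3] at h
  linarith

theorem mean_mem_Icc {f : L1} (hf : f ∈ fuzzySets) : mean f ∈ Set.Icc (0 : ℝ) 1 := by
  have := harmonic_mem_Icc hf (z := 0) (by simp)
  simpa [hardy_zero] using this

/-- The exponent has imaginary part `π/2 - πu`, where `u ∈ [0,1]` is the harmonic extension, so the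
cosine of that angle is nonnegative. -/
theorem re_rotation_mul_expHardy_nonneg {f : L1} (hf : f ∈ fuzzySets) {z : ℂ} (hz : ‖z‖ < 1) :
    0 ≤ (rotation (mean f) * expHardy f z).re := by
  obtain ⟨h0, h1⟩ := harmonic_mem_Icc hf hz
  have : rotation (mean f) * expHardy f z = Complex.exp
      (((2 * Real.pi * (hardy f z).im : ℝ) : ℂ) +
        ((Real.pi / 2 - Real.pi * (mean f + 2 * (hardy f z).re) : ℝ) : ℂ) * Complex.I) := by
    have hI : rotation (mean f) =
        Complex.exp (Real.pi / 2 * Complex.I) * Complex.exp (-(Complex.I * Real.pi * mean f)) := by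
      rw [Complex.exp_pi_div_two_mul_I, rotation]
    rw [hI, expHardy, ← Complex.exp_add, ← Complex.exp_add]
    congr 1
    conv_lhs => rw [← Complex.re_add_im (hardy f z)]
    push_cast
    linear_combination (-2 * Real.pi * (hardy f z).im) * Complex.I_sq
  rw [this, Complex.exp_re]
  refine mul_nonneg (Real.exp_pos _).le (Real.cos_nonneg_of_mem_Icc ?_)
  have hpi := Real.pi_pos
  simp only [Complex.add_im, Complex.ofReal_im, Complex.mul_im, Complex.I_re, mul_zero,
    Complex.ofReal_re, Complex.I_im, mul_one, zero_add, add_zero, Set.mem_Icc]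
  constructor <;> nlinarith

end FuzzyCircle

/-! ### Positive Toeplitz forms and nonnegative harmonic functions -/

namespace FuzzyCircle

open scoped ComplexConjugate Topology ComplexOrder

/-- The real trigonometric series `c + 2 Re ∑_{k ≥ 0} d_k e^{i(k+1)t}`. -/
noncomputable def trigSeries (c : ℝ) (d : ℕ → ℂ) (t : S1) : ℝ :=
  c + 2 * (∑' k : ℕ, d k * fourier ((k : ℤ) + 1) t).re

theorem continuous_tsum_fourier {d : ℕ → ℂ} (hd : Summable d) :
    Continuous (fun t : S1 => ∑' k : ℕ, d k * fourier ((k : ℤ) + 1) t) := by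
  refine continuous_tsum (fun k => continuous_const.mul (fourier _).continuous) hd.norm
    fun k t => ?_
  rw [norm_mul, norm_fourier_apply, mul_one]

theorem continuous_trigSeries (c : ℝ) {d : ℕ → ℂ} (hd : Summable d) :
    Continuous (trigSeries c d) :=
  continuous_const.add (continuous_const.mul
    (Complex.continuous_re.comp (continuous_tsum_fourier hd)))

theorem integrable_of_continuous {E : Type*} [NormedAddCommGroup E] {g : S1 → E}
    (hg : Continuous g) : Integrable g arcMeasure :=
  hg.integrable_of_hasCompactSupport (HasCompactSupport.of_compactSpace g)

theorem integral_tsum_fourier {d : ℕ → ℂ} (hd : Summable d) (j : ℤ) :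
    HasSum (fun k : ℕ => if (k : ℤ) + 1 + j = 0 then d k else 0)
      (∫ t : S1, (∑' k : ℕ, d k * fourier ((k : ℤ) + 1) t) * fourier j t ∂arcMeasure) := by
  have hF := hasSum_integral_of_summable_integral_norm (μ := arcMeasure)
    (F := fun (k : ℕ) (t : S1) => d k * fourier ((k : ℤ) + 1) t * fourier j t)
    (fun k => integrable_of_continuous
      ((continuous_const.mul (fourier _).continuous).mul (fourier _).continuous)) (by
      simpa only [norm_mul, norm_fourier_apply, mul_one, integral_const, probReal_univ,
        one_smul] using hd.norm)
  have h1 : ∀ k : ℕ, ∫ t : S1, d k * fourier ((k : ℤ) + 1) t * fourier j t ∂arcMeasure =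
      if (k : ℤ) + 1 + j = 0 then d k else 0 := fun k => by
    simp_rw [mul_assoc, ← fourier_add]
    rw [integral_const_mul, integral_fourier, mul_ite, mul_one, mul_zero]
  simp_rw [h1, tsum_mul_right] at hF
  exact hF

theorem integral_tsum_fourier_of_nonneg {d : ℕ → ℂ} (hd : Summable d) {j : ℤ} (hj : 0 ≤ j) :
    ∫ t : S1, (∑' k : ℕ, d k * fourier ((k : ℤ) + 1) t) * fourier j t ∂arcMeasure = 0 := by
  refine (integral_tsum_fourier hd j).unique ?_
  refine hasSum_zero.congr_fun fun k => ?_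
  rw [if_neg (by omega)]

theorem integral_tsum_fourier_neg {d : ℕ → ℂ} (hd : Summable d) (m : ℕ) :
    ∫ t : S1, (∑' k : ℕ, d k * fourier ((k : ℤ) + 1) t) * fourier (-((m : ℤ) + 1)) t ∂arcMeasure =
      d m := by
  refine (integral_tsum_fourier hd _).unique ?_
  refine (hasSum_ite_eq m (d m)).congr_fun fun k => ?_
  by_cases h : k = m
  · rw [if_pos h, if_pos (by omega), h]
  · rw [if_neg h, if_neg (by omega)]

theorem fcoef_trigSeries (c : ℝ) {d : ℕ → ℂ} (hd : Summable d) (j : ℤ) :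
    fcoef (trigSeries c d) j = (if j = 0 then (c : ℂ) else 0) +
      ∫ t : S1, (∑' k : ℕ, d k * fourier ((k : ℤ) + 1) t) * fourier j t ∂arcMeasure +
      conj (∫ t : S1, (∑' k : ℕ, d k * fourier ((k : ℤ) + 1) t) * fourier (-j) t ∂arcMeasure) := by
  have hT := continuous_tsum_fourier hd
  have hTi : ∀ j, Integrable (fun t : S1 => (∑' k : ℕ, d k * fourier ((k : ℤ) + 1) t) *
      fourier j t) arcMeasure :=
    fun j => integrable_of_continuous (hT.mul (fourier j).continuous)
  have hTc : Integrable (fun t : S1 => conj ((∑' k : ℕ, d k * fourier ((k : ℤ) + 1) t) *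
      fourier (-j) t)) arcMeasure :=
    integrable_of_continuous (Complex.continuous_conj.comp (hT.mul (fourier (-j)).continuous))
  have hc : ∫ t : S1, (c : ℂ) * fourier j t ∂arcMeasure = if j = 0 then (c : ℂ) else 0 :=
    fcoef_const c j
  rw [← hc, ← integral_conj, ← integral_add, ← integral_add _ hTc]
  · refine integral_congr_ae (ae_of_all _ fun t => ?_)
    simp only [trigSeries, map_mul, fourier_neg, Complex.conj_conj]
    have := Complex.add_conj (∑' k : ℕ, d k * fourier ((k : ℤ) + 1) t)
    push_cast at this ⊢
    rw [add_mul, ← this]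
    ring
  · exact (integrable_of_continuous (continuous_const.mul (fourier j).continuous)).add (hTi j)
  · exact integrable_of_continuous (continuous_const.mul (fourier j).continuous)
  · exact hTi j

theorem fcoef_trigSeries_zero (c : ℝ) {d : ℕ → ℂ} (hd : Summable d) :
    fcoef (trigSeries c d) 0 = c := by
  rw [fcoef_trigSeries c hd, neg_zero, integral_tsum_fourier_of_nonneg hd le_rfl]
  simp

theorem fcoef_trigSeries_neg (c : ℝ) {d : ℕ → ℂ} (hd : Summable d) (m : ℕ) :
    fcoef (trigSeries c d) (-((m : ℤ) + 1)) = d m := by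
  rw [fcoef_trigSeries c hd, integral_tsum_fourier_neg hd, neg_neg,
    integral_tsum_fourier_of_nonneg hd (by omega), if_neg (by omega)]
  simp

theorem fcoef_trigSeries_pos (c : ℝ) {d : ℕ → ℂ} (hd : Summable d) (m : ℕ) :
    fcoef (trigSeries c d) ((m : ℤ) + 1) = conj (d m) := by
  rw [← neg_neg ((m : ℤ) + 1), fcoef_neg, fcoef_trigSeries_neg c hd]

/-- Hermitian sequences whose harmonic extension is nonnegative. -/
theorem posToeplitz_of_harmonic_nonneg {s : ℤ → ℂ} (hs : IsHermitianSeq s) {G : ℂ → ℂ}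
    (hG : ∀ z : ℂ, ‖z‖ < 1 → HasSum (fun k : ℕ => s ((k : ℤ) + 1) * z ^ (k + 1)) (G z))
    (hpos : ∀ z : ℂ, ‖z‖ < 1 → 0 ≤ (s 0).re + 2 * (G z).re) : PosToeplitz s := by
  have hs0 : s 0 = (s 0).re := (Complex.conj_eq_iff_re.mp (hs 0).symm).symm
  refine posToeplitz_of_re_nonneg hs fun n v => ?_
  -- The damped sequence `s_k r^{|k|}` consists of the Fourier coefficients of a nonnegative
  -- continuous function, namely the harmonic extension on the circle of radius `r`. Its Toeplitz
  -- form is the integral of that function against the squared modulus of a trigonometric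
  -- polynomial. The claim follows as `r → 1`.
  have key : ∀ r : ℝ, 0 < r → r < 1 → 0 ≤ (∑ i : Fin n, ∑ j : Fin n,
      conj (v i) * v j * (s ((j : ℤ) - i) * (r : ℂ) ^ ((j : ℤ) - i).natAbs)).re := by
    intro r hr0 hr1
    let d : ℕ → ℂ := fun k => s ((k : ℤ) + 1) * (r : ℂ) ^ (k + 1)
    have hrn : ‖(r : ℂ)‖ < 1 := by rwa [Complex.norm_real, Real.norm_of_nonneg hr0.le]
    have hd : Summable d := (hG r hrn).summable
    have hg0 : ∀ t, 0 ≤ trigSeries (s 0).re d t := fun t => by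
      have hz : ‖(r : ℂ) * fourier 1 t‖ < 1 := by
        rwa [norm_mul, norm_fourier_apply, mul_one]
      have h1 : ∑' k : ℕ, d k * fourier ((k : ℤ) + 1) t = G ((r : ℂ) * fourier 1 t) := by
        rw [← (hG _ hz).tsum_eq]
        refine tsum_congr fun k => ?_
        have : ∀ m : ℕ, (fourier (m : ℤ) t : ℂ) = fourier 1 t ^ m := fun m => by
          induction m with
          | zero => simp
          | succ m ih => rw [Nat.cast_succ, fourier_add, ih, pow_succ]
        have h2 := this (k + 1)
        push_cast at h2
        rw [h2, mul_pow]
        ring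
      rw [trigSeries, h1]
      exact hpos _ hz
    have hcoef : ∀ k : ℤ, fcoef (trigSeries (s 0).re d) (-k) = s k * (r : ℂ) ^ k.natAbs := by
      rintro ((_ | k) | k)
      · simpa [← hs0] using fcoef_trigSeries_zero (s 0).re hd
      · have := fcoef_trigSeries_neg (s 0).re hd k
        exact this
      · have := fcoef_trigSeries_pos (s 0).re hd k
        rw [Int.neg_negSucc, Nat.cast_succ, this, Int.natAbs_negSucc, Int.negSucc_eq, hs]
        simp [d]
    have hgi := integrable_of_continuous (continuous_trigSeries (s 0).re hd)
    have : ∑ i : Fin n, ∑ j : Fin n,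
        conj (v i) * v j * (s ((j : ℤ) - i) * (r : ℂ) ^ ((j : ℤ) - i).natAbs) =
        ((∫ t, trigSeries (s 0).re d t *
          Complex.normSq (∑ j : Fin n, v j * fourier (-(j : ℤ)) t) ∂arcMeasure : ℝ) : ℂ) := by
      rw [← integral_complex_ofReal]
      have h1 : ∀ t : S1, ((trigSeries (s 0).re d t *
          Complex.normSq (∑ j : Fin n, v j * fourier (-(j : ℤ)) t) : ℝ) : ℂ) =
          ∑ i : Fin n, ∑ j : Fin n, conj (v i) * v j *
            (trigSeries (s 0).re d t * fourier (-((j : ℤ) - i)) t) := fun t => by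
        rw [Complex.ofReal_mul, Complex.normSq_eq_conj_mul_self, map_sum, Finset.sum_mul_sum,
          Finset.mul_sum]
        refine Finset.sum_congr rfl fun i _ => ?_
        rw [Finset.mul_sum]
        refine Finset.sum_congr rfl fun j _ => ?_
        rw [neg_sub, sub_eq_add_neg, fourier_add, map_mul, fourier_neg (n := (i : ℤ)),
          Complex.conj_conj]
        ring
      simp_rw [h1]
      rw [integral_finsetSum _ fun i _ => integrable_finsetSum _ fun j _ =>
        (integrable_mul_fourier hgi _).const_mul _]
      refine Finset.sum_congr rfl fun i _ => ?_
      rw [integral_finsetSum _ fun j _ => (integrable_mul_fourier hgi _).const_mul _]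
      refine Finset.sum_congr rfl fun j _ => ?_
      rw [integral_const_mul, ← hcoef]
      rfl
    rw [this, Complex.ofReal_re]
    exact integral_nonneg fun t => mul_nonneg (hg0 t) (Complex.normSq_nonneg _)
  have hcont : Continuous fun r : ℝ => (∑ i : Fin n, ∑ j : Fin n,
      conj (v i) * v j * (s ((j : ℤ) - i) * (r : ℂ) ^ ((j : ℤ) - i).natAbs)).re := by fun_prop
  have hlim := (hcont.tendsto 1).mono_left (nhdsWithin_le_nhds (s := Set.Iio 1))
  simp only [Complex.ofReal_one, one_pow, mul_one] at hlim
  refine ge_of_tendsto hlim ?_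
  have : ∀ᶠ r : ℝ in 𝓝[<] 1, r ∈ Set.Ioo (0 : ℝ) 1 := Ioo_mem_nhdsLT zero_lt_one
  exact this.mono fun r hr => key r hr.1 hr.2

/-- The nonlinear coefficients of a fuzzy set are a positive sequence. -/
theorem posToeplitz_nonlinear {f : L1} (hf : f ∈ fuzzySets) : PosToeplitz (nonlinear f) := by
  refine posToeplitz_of_harmonic_nonneg (isHermitianSeq_nonlinear f)
    (fun z hz => hasSum_nonlinear f hz) fun z hz => ?_
  have h := re_rotation_mul_expHardy_nonneg hf hz
  have h0 : (rotation (mean f)).re = Real.sin (Real.pi * mean f) := by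
    rw [rotation_eq, Complex.add_re, Complex.ofReal_re, Complex.re_ofReal_mul, Complex.I_re,
      mul_zero, add_zero]
  rw [nonlinear_zero', Complex.ofReal_re, mul_sub, mul_one, Complex.sub_re, h0]
  linarith

section Converse

variable {s : ℤ → ℂ}

theorem PosToeplitz.zero_eq_re (hs : PosToeplitz s) : s 0 = (s 0).re :=
  (Complex.conj_eq_iff_re.mp (hs.isHermitianSeq 0).symm).symm

theorem PosToeplitz.re_zero_nonneg (hs : PosToeplitz s) : 0 ≤ (s 0).re := by
  have : 0 ≤ toeplitzMat s 1 0 0 := (hs 1).diag_nonneg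
  exact (Complex.le_def.mp this).1

/-- The minor on the indices `0` and `k` is `s₀² - |s_k|²`. -/
theorem PosToeplitz.norm_le (hs : PosToeplitz s) (k : ℕ) : ‖s k‖ ≤ (s 0).re := by
  have h := ((hs (k + 1)).submatrix ![0, Fin.last k]).det_nonneg
  rw [Matrix.det_fin_two] at h
  simp only [toeplitzMat, Matrix.submatrix_apply, Matrix.cons_val_zero, Matrix.cons_val_one,
    Matrix.of_apply, sub_self, Fin.val_zero, Fin.val_last, Nat.cast_zero, sub_zero, zero_sub] at h
  rw [hs.isHermitianSeq k, Complex.mul_conj, hs.zero_eq_re, ← Complex.ofReal_mul,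
    ← Complex.ofReal_sub] at h
  have h1 : 0 ≤ (s 0).re * (s 0).re - Complex.normSq (s k) := by exact_mod_cast h
  rw [Complex.normSq_eq_norm_sq] at h1
  exact abs_le_of_sq_le_sq' (by nlinarith) hs.re_zero_nonneg |>.2

theorem PosToeplitz.summable (hs : PosToeplitz s) {z : ℂ} (hz : ‖z‖ < 1) :
    Summable (fun k : ℕ => s ((k : ℤ) + 1) * z ^ (k + 1)) := by
  refine Summable.of_norm_bounded (g := fun k => (s 0).re * ‖z‖ ^ (k + 1))
    (Summable.mul_left _ ?_) fun k => ?_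
  · exact (summable_geometric_of_lt_one (norm_nonneg z) hz).comp_injective (add_left_injective 1)
  · rw [norm_mul, norm_pow]
    exact mul_le_mul_of_nonneg_right (by exact_mod_cast hs.norm_le (k + 1)) (by positivity)

/-- The Toeplitz form of `s` at the vector `(1, z, …, z^{n-1})`. -/
noncomputable def geometricForm (s : ℤ → ℂ) (z : ℂ) (n : ℕ) : ℂ :=
  ∑ i : Fin n, ∑ j : Fin n, conj (z ^ (i : ℕ)) * z ^ (j : ℕ) * s ((j : ℤ) - (i : ℤ))

theorem PosToeplitz.geometricForm_nonneg (hs : PosToeplitz s) (z : ℂ) (n : ℕ) :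
    0 ≤ (geometricForm s z n).re := by
  have h := (hs n).dotProduct_mulVec_nonneg fun j => z ^ (j : ℕ)
  rw [dotProduct_toeplitzMat] at h
  exact (Complex.le_def.mp h).1

/-- Without the first row and column the form is `|z|²` times the previous one; that row and column
contribute a partial sum of the harmonic extension. -/
theorem geometricForm_succ (hs : IsHermitianSeq s) (z : ℂ) (n : ℕ) :
    (geometricForm s z (n + 1)).re = ‖z‖ ^ 2 * (geometricForm s z n).re +
      ((s 0).re + 2 * (∑ k ∈ Finset.range n, s ((k : ℤ) + 1) * z ^ (k + 1)).re) := by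
  have h1 : geometricForm s z (n + 1) = ((‖z‖ ^ 2 : ℝ) : ℂ) * geometricForm s z n + (s 0 +
      (∑ k ∈ Finset.range n, s ((k : ℤ) + 1) * z ^ (k + 1) +
        conj (∑ k ∈ Finset.range n, s ((k : ℤ) + 1) * z ^ (k + 1)))) := by
    have hz : ((‖z‖ ^ 2 : ℝ) : ℂ) = conj z * z := by
      rw [← Complex.normSq_eq_norm_sq, Complex.normSq_eq_conj_mul_self]
    rw [hz, geometricForm, Fin.sum_univ_succ, Fin.sum_univ_succ]
    simp_rw [Fin.sum_univ_succ (n := n)]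
    rw [Finset.sum_add_distrib, ← Fin.sum_univ_eq_sum_range
      (fun k => s ((k : ℤ) + 1) * z ^ (k + 1)), map_sum, geometricForm, Finset.mul_sum]
    have e1 : ∀ i j : Fin n, conj (z ^ (i.succ : ℕ)) * z ^ (j.succ : ℕ) *
        s (((j.succ : ℕ) : ℤ) - ((i.succ : ℕ) : ℤ)) =
        conj z * z * (conj (z ^ (i : ℕ)) * z ^ (j : ℕ) * s ((j : ℤ) - (i : ℤ))) := fun i j => by
      rw [Fin.val_succ, Fin.val_succ, pow_succ, pow_succ, map_mul]
      rw [show (((j : ℕ) + 1 : ℕ) : ℤ) - (((i : ℕ) + 1 : ℕ) : ℤ) = (j : ℤ) - i by push_cast; ring]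
      ring
    have e2 : ∀ i : Fin n, conj (z ^ (i.succ : ℕ)) * z ^ ((0 : Fin (n + 1)) : ℕ) *
        s ((((0 : Fin (n + 1)) : ℕ) : ℤ) - ((i.succ : ℕ) : ℤ)) =
        conj (s (((i : ℕ) : ℤ) + 1) * z ^ ((i : ℕ) + 1)) := fun i => by
      rw [map_mul, ← hs]
      simp [mul_comm]
    simp_rw [e1, e2, ← Finset.mul_sum]
    simp only [Fin.val_zero, pow_zero, map_one, one_mul, Nat.cast_zero, sub_zero, Fin.val_succ,
      Nat.cast_add, Nat.cast_one]
    simp_rw [mul_comm (z ^ _) (s _)]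
    ring
  rw [h1, Complex.add_re, Complex.re_ofReal_mul, Complex.add_re, Complex.add_re, Complex.conj_re]
  ring

/-- If the limit `L` of the partial sums were negative, each late step of the recursion would lower
the nonnegative form by more than `|L|/2`, because the factor `‖z‖² ≤ 1` does not increase it. The
form would become negative. -/
theorem PosToeplitz.harmonic_nonneg (hs : PosToeplitz s) {z : ℂ} (hz : ‖z‖ < 1) :
    0 ≤ (s 0).re + 2 * (∑' k : ℕ, s ((k : ℤ) + 1) * z ^ (k + 1)).re := by
  set A : ℕ → ℝ := fun n =>
    (s 0).re + 2 * (∑ k ∈ Finset.range n, s ((k : ℤ) + 1) * z ^ (k + 1)).re with hA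
  set L : ℝ := (s 0).re + 2 * (∑' k : ℕ, s ((k : ℤ) + 1) * z ^ (k + 1)).re with hL
  have hlim : Tendsto A atTop (𝓝 L) := by
    have h1 := (hs.summable hz).hasSum.tendsto_sum_nat
    exact ((Complex.continuous_re.tendsto _).comp h1).const_mul 2 |>.const_add _
  by_contra! hneg
  obtain ⟨N, hN⟩ := eventually_atTop.mp (hlim.eventually_lt_const (show L < L / 2 by linarith))
  have hstep : ∀ m, (geometricForm s z (N + m)).re ≤ (geometricForm s z N).re + m * (L / 2) := by
    intro m
    induction m with
    | zero => simp
    | succ m ih =>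
      have h1 := geometricForm_succ hs.isHermitianSeq z (N + m)
      have h2 : A (N + m) < L / 2 := hN _ (by omega)
      have h3 := hs.geometricForm_nonneg z (N + m)
      have h4 : ‖z‖ ^ 2 * (geometricForm s z (N + m)).re ≤ (geometricForm s z (N + m)).re :=
        mul_le_of_le_one_left h3 (pow_le_one₀ (norm_nonneg _) hz.le)
      rw [← add_assoc, h1]
      push_cast
      simp only [hA] at h2
      linarith
  obtain ⟨m, hm⟩ := exists_nat_gt ((geometricForm s z N).re / (-(L / 2)))
  have h5 := hs.geometricForm_nonneg z (N + m)
  have h6 := hstep m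
  rw [div_lt_iff₀ (by linarith)] at hm
  linarith

end Converse

end FuzzyCircle

/-! ### Boundary values, and fuzzy sets with prescribed nonlinear coefficients -/

namespace FuzzyCircle

open scoped ComplexConjugate Topology

/-- `L²` of the circle. -/
abbrev L2C : Type := Lp ℂ 2 arcMeasure

theorem hasSum_sq_fourierCoeff_norm (u : L2C) :
    HasSum (fun i => ‖fourierCoeff u i‖ ^ 2) (‖u‖ ^ 2) := by
  simp_rw [← fourierBasis_repr]
  have h1 : HasSum (fun i => ‖fourierBasis.repr u i‖ ^ 2) (‖fourierBasis.repr u‖ ^ 2) := by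
    apply_mod_cast lp.hasSum_norm ?_ (fourierBasis.repr u)
    simp
  rwa [LinearIsometryEquiv.norm_map] at h1

/-- The points of the complex plane in the real interval `[0, 1]`. -/
def unitSegment : Set ℂ := {w | w.re ∈ Set.Icc (0 : ℝ) 1 ∧ w.im = 0}

theorem isClosed_unitSegment : IsClosed unitSegment :=
  (isClosed_Icc.preimage Complex.continuous_re).inter
    (isClosed_singleton.preimage Complex.continuous_im)

theorem norm_le_one_of_ae_mem {u : L2C} (hu : ∀ᵐ t ∂arcMeasure, u t ∈ unitSegment) : ‖u‖ ≤ 1 := by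
  have := Lp.norm_le_of_ae_bound (p := 2) (f := u) zero_le_one (hu.mono fun t ht => ?_)
  · simpa [measureUnivNNReal] using this
  · obtain ⟨h1, h2⟩ := ht
    have : u t = ((u t).re : ℂ) := Complex.ext rfl (by simpa using h2)
    rw [this, Complex.norm_real, Real.norm_of_nonneg h1.1]
    exact h1.2

/-- Fourier coefficients of the boundary function of `c + 2 Re ∑ a_k z^k`. -/
noncomputable def boundaryCoeff (c : ℝ) (a : ℕ → ℂ) : ℤ → ℂ
  | Int.ofNat 0 => c
  | Int.ofNat (k + 1) => conj (a (k + 1))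
  | Int.negSucc k => a (k + 1)

theorem exists_dilate {a : ℕ → ℂ} {H : ℂ → ℂ} {c : ℝ} (hH : HasDiskSeries a H) (h0 : a 0 = 0)
    (hmem : ∀ z, ‖z‖ < 1 → c + 2 * (H z).re ∈ Set.Icc (0 : ℝ) 1) {r : ℝ} (hr0 : 0 < r)
    (hr1 : r < 1) :
    ∃ u : L2C, (∀ᵐ t ∂arcMeasure, u t ∈ unitSegment) ∧
      ∀ k : ℤ, fourierCoeff u k = boundaryCoeff c a k * (r : ℂ) ^ k.natAbs := by
  -- `coeff` pairs with `e^{ikt}` but `fourierCoeff` with `e^{-ikt}`. The boundary function is thus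
  -- `c + 2 Re H(e^{-it})`, which explains the conjugates.
  let d : ℕ → ℂ := fun k => conj (a (k + 1)) * (r : ℂ) ^ (k + 1)
  have hrn : ‖(r : ℂ)‖ < 1 := by rwa [Complex.norm_real, Real.norm_of_nonneg hr0.le]
  have hd : Summable d := by
    refine (Complex.summable_conj.mpr (hH.shift hrn).summable).congr fun k => ?_
    simp [d]
  have hval : ∀ t, trigSeries c d t ∈ Set.Icc (0 : ℝ) 1 := fun t => by
    have hz : ‖(r : ℂ) * conj (fourier 1 t : ℂ)‖ < 1 := by
      rwa [norm_mul, RCLike.norm_conj, norm_fourier_apply, mul_one]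
    have h1 : ∑' k : ℕ, d k * fourier ((k : ℤ) + 1) t = conj (H (r * conj (fourier 1 t : ℂ))) := by
      have h2 := hH.shift hz
      rw [h0, sub_zero] at h2
      rw [← h2.tsum_eq, Complex.conj_tsum]
      refine tsum_congr fun k => ?_
      have : ∀ m : ℕ, (fourier (m : ℤ) t : ℂ) = fourier 1 t ^ m := fun m => by
        induction m with
        | zero => simp
        | succ m ih => rw [Nat.cast_succ, fourier_add, ih, pow_succ]
      have h3 := this (k + 1)
      push_cast at h3
      rw [h3, map_mul, map_pow, map_mul, Complex.conj_conj, Complex.conj_ofReal, mul_pow]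
      simp only [d]
      ring
    rw [trigSeries, h1, Complex.conj_re]
    exact hmem _ hz
  let φ : C(S1, ℂ) := ⟨fun t => (trigSeries c d t : ℂ),
    Complex.continuous_ofReal.comp (continuous_trigSeries c hd)⟩
  refine ⟨ContinuousMap.toLp 2 arcMeasure ℂ φ, ?_, fun k => ?_⟩
  · filter_upwards [ContinuousMap.coeFn_toLp (p := 2) arcMeasure (𝕜 := ℂ) φ] with t ht
    rw [ht]
    exact ⟨by simpa [φ] using hval t, by simp [φ]⟩
  · have h1 : fourierCoeff φ k = fcoef (trigSeries c d) (-k) := by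
      simp only [fourierCoeff, fcoef]
      refine integral_congr_ae (ae_of_all _ fun t => ?_)
      simp only [smul_eq_mul, φ, ContinuousMap.coe_mk]
      exact mul_comm _ _
    rw [fourierCoeff_toLp, h1]
    rcases k with (_ | k) | k
    · simpa [boundaryCoeff] using fcoef_trigSeries_zero c hd
    · exact fcoef_trigSeries_neg c hd k
    · have := fcoef_trigSeries_pos c hd k
      rw [Int.neg_negSucc, Nat.cast_succ, this, Int.natAbs_negSucc]
      simp [d, boundaryCoeff]

/-- Fatou's theorem for functions with bounded real part, in `L²`. -/
theorem exists_boundary {a : ℕ → ℂ} {H : ℂ → ℂ} {c : ℝ} (hH : HasDiskSeries a H) (h0 : a 0 = 0)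
    (hmem : ∀ z, ‖z‖ < 1 → c + 2 * (H z).re ∈ Set.Icc (0 : ℝ) 1) :
    ∃ u : L2C, (∀ᵐ t ∂arcMeasure, u t ∈ unitSegment) ∧
      ∀ k : ℤ, fourierCoeff u k = boundaryCoeff c a k := by
  set D := boundaryCoeff c a with hD
  let r : ℕ → ℝ := fun n => 1 - 1 / ((n : ℝ) + 2)
  have hr0 : ∀ n, 0 < r n := fun n => by
    have : 1 / ((n : ℝ) + 2) < 1 := by
      rw [div_lt_one (by positivity)]
      have : (0 : ℝ) ≤ n := n.cast_nonneg
      linarith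
    simp only [r]
    linarith
  have hr1 : ∀ n, r n < 1 := fun n => by
    have : 0 < 1 / ((n : ℝ) + 2) := by positivity
    simp only [r]
    linarith
  have hrlim : Tendsto r atTop (𝓝 1) := by
    have h1 : Tendsto (fun n : ℕ => 1 / ((n : ℝ) + 2)) atTop (𝓝 0) :=
      tendsto_const_nhds.div_atTop
        (tendsto_atTop_add_const_right _ _ tendsto_natCast_atTop_atTop)
    have h2 := h1.const_sub 1
    rwa [sub_zero] at h2
  choose U hU hUc using fun n => exists_dilate hH h0 hmem (hr0 n) (hr1 n)
  have hnorm : ∀ n k, ‖fourierCoeff (U n) k‖ = ‖D k‖ * r n ^ k.natAbs := fun n k => by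
    rw [hUc, norm_mul, norm_pow, Complex.norm_real, Real.norm_of_nonneg (hr0 n).le]
  -- Bessel's inequality for the dilates, whose norms are at most `1`, passes to the limit `r → 1`
  -- in each finite sum.
  have hbound : ∀ F : Finset ℤ, ∑ k ∈ F, ‖D k‖ ^ 2 ≤ 1 := by
    intro F
    have h1 : ∀ n, ∑ k ∈ F, (‖D k‖ * r n ^ k.natAbs) ^ 2 ≤ 1 := fun n => by
      simp_rw [← hnorm]
      refine (sum_le_hasSum F (fun i _ => by positivity)
        (hasSum_sq_fourierCoeff_norm (U n))).trans ?_
      exact pow_le_one₀ (norm_nonneg _) (norm_le_one_of_ae_mem (hU n))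
    have hcont : Continuous fun x : ℝ => ∑ k ∈ F, (‖D k‖ * x ^ k.natAbs) ^ 2 := by fun_prop
    have h2 := (hcont.tendsto 1).comp hrlim
    simp only [one_pow, mul_one] at h2
    exact le_of_tendsto h2 (Eventually.of_forall h1)
  have hsum : Summable fun k => ‖D k‖ ^ 2 := summable_of_sum_le (fun _ => by positivity) hbound
  have hmemlp : Memℓp D 2 := by
    refine memℓp_gen ?_
    simpa using hsum
  let u : L2C := fourierBasis.repr.symm ⟨D, hmemlp⟩
  have huc : ∀ k, fourierCoeff u k = D k := fun k => by
    rw [← fourierBasis_repr]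
    simp [u]
  refine ⟨u, ?_, huc⟩
  have hdiff : ∀ n k, ‖fourierCoeff (U n - u : L2C) k‖ ^ 2 =
      ‖D k‖ ^ 2 * (1 - r n ^ k.natAbs) ^ 2 := by
    intro n k
    rw [← fourierBasis_repr, map_sub, lp.coeFn_sub, Pi.sub_apply, fourierBasis_repr,
      fourierBasis_repr, huc, hUc, ← mul_pow, ← sq_abs (‖D k‖ * (1 - r n ^ k.natAbs)), abs_mul,
      abs_norm, show D k * (r n : ℂ) ^ k.natAbs - D k = D k * (((r n ^ k.natAbs - 1 : ℝ)) : ℂ) by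
        push_cast; ring, norm_mul, Complex.norm_real, Real.norm_eq_abs, abs_sub_comm]
  have hlim : Tendsto (fun n => ‖U n - u‖ ^ 2) atTop (𝓝 0) := by
    have h1 : ∀ n, ‖U n - u‖ ^ 2 = ∑' k, ‖D k‖ ^ 2 * (1 - r n ^ k.natAbs) ^ 2 := fun n => by
      rw [← (hasSum_sq_fourierCoeff_norm (U n - u)).tsum_eq]
      exact tsum_congr fun k => hdiff n k
    simp_rw [h1]
    have h2 := tendsto_tsum_of_dominated_convergence (𝓕 := atTop)
      (f := fun n (k : ℤ) => ‖D k‖ ^ 2 * (1 - r n ^ k.natAbs) ^ 2) (g := fun _ => (0 : ℝ)) hsum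
      (fun k => ?_) (Eventually.of_forall fun n k => ?_)
    · simpa using h2
    · have hcont : Continuous fun x : ℝ => ‖D k‖ ^ 2 * (1 - x ^ k.natAbs) ^ 2 := by fun_prop
      have := (hcont.tendsto 1).comp hrlim
      simp only [one_pow, sub_self, ne_eq, OfNat.ofNat_ne_zero, not_false_eq_true, zero_pow,
        mul_zero] at this
      exact this
    · have h3 : 0 ≤ r n ^ k.natAbs := pow_nonneg (hr0 n).le _
      have h4 : r n ^ k.natAbs ≤ 1 := pow_le_one₀ (hr0 n).le (hr1 n).le
      rw [Real.norm_of_nonneg (by positivity)]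
      exact mul_le_of_le_one_right (by positivity) (pow_le_one₀ (by linarith) (by linarith))
  have hlim' : Tendsto U atTop (𝓝 u) := by
    rw [tendsto_iff_norm_sub_tendsto_zero]
    have := (Real.continuous_sqrt.tendsto 0).comp hlim
    simpa [Function.comp_def, Real.sqrt_sq] using this
  -- A subsequence converges almost everywhere, so the limit keeps its values in the closed segment.
  obtain ⟨ns, -, hns⟩ := (tendstoInMeasure_of_tendsto_Lp hlim').exists_seq_tendsto_ae
  filter_upwards [hns, ae_all_iff.mpr hU] with t ht1 ht2
  exact isClosed_unitSegment.mem_of_tendsto ht1 (Eventually.of_forall fun n => ht2 _)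

theorem exists_fuzzySet {a : ℕ → ℂ} {H : ℂ → ℂ} {c : ℝ} (hH : HasDiskSeries a H) (h0 : a 0 = 0)
    (hmem : ∀ z, ‖z‖ < 1 → c + 2 * (H z).re ∈ Set.Icc (0 : ℝ) 1) :
    ∃ f ∈ fuzzySets, mean f = c ∧ ∀ k : ℕ, coeff f ((k : ℤ) + 1) = a (k + 1) := by
  obtain ⟨u, hu, huc⟩ := exists_boundary hH h0 hmem
  have hmem1 : MemLp (fun t => (u t).re) 1 arcMeasure :=
    ((Lp.memLp u).re).mono_exponent (by norm_num)
  let f : L1 := hmem1.toLp _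
  have hf : f =ᵐ[arcMeasure] fun t => (u t).re := hmem1.coeFn_toLp
  have hcoef : ∀ k : ℤ, coeff f k = boundaryCoeff c a (-k) := fun k => by
    rw [← huc, coeff, fourierCoeff]
    refine integral_congr_ae ?_
    filter_upwards [hf, hu] with t ht1 ht2
    have h1 : u t = ((u t).re : ℂ) := Complex.ext rfl (by simpa using ht2.2)
    rw [ht1, ← h1, neg_neg, smul_eq_mul, mul_comm]
  refine ⟨f, ?_, ?_, fun k => ?_⟩
  · change ∀ᵐ t ∂arcMeasure, f t ∈ Set.Icc (0 : ℝ) 1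
    filter_upwards [hf, hu] with t ht1 ht2
    rw [ht1]
    exact ht2.1
  · have := hcoef 0
    rw [coeff_zero] at this
    have h2 : boundaryCoeff c a (-0) = c := rfl
    rw [h2] at this
    exact_mod_cast this
  · rw [hcoef, ← Int.negSucc_eq]
    rfl

/-- A nonnegative real part that is positive somewhere is positive. -/
theorem re_pos_of_nonneg {F : ℂ → ℂ} (hF : DifferentiableOn ℂ F (Metric.ball 0 1))
    (h : ∀ z, ‖z‖ < 1 → 0 ≤ (F z).re) (h0 : 0 < (F 0).re) {z : ℂ} (hz : ‖z‖ < 1) :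
    0 < (F z).re := by
  have hz' : z ∈ Metric.ball (0 : ℂ) 1 := by simpa using hz
  have han : AnalyticOnNhd ℂ F (Metric.ball 0 1) := hF.analyticOnNhd Metric.isOpen_ball
  rcases han.is_constant_or_isOpen (convex_ball 0 1).isPreconnected with ⟨w, hw⟩ | hopen
  · rw [hw z hz', ← hw 0 (by simp)]
    exact h0
  · refine lt_of_le_of_ne (h z hz) fun heq => ?_
    -- An image point on the imaginary axis would be interior to the image, which would then reach
    -- into the left half-plane.
    have ho := hopen _ subset_rfl Metric.isOpen_ball
    obtain ⟨ε, hε, hball⟩ := Metric.isOpen_iff.mp ho (F z) ⟨z, hz', rfl⟩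
    obtain ⟨y, hy, hFy⟩ := hball (show F z - (ε / 2 : ℝ) ∈ Metric.ball (F z) ε by
      rw [Metric.mem_ball, dist_eq_norm, sub_sub_cancel_left, norm_neg, Complex.norm_real,
        Real.norm_of_nonneg (by positivity)]
      linarith)
    have := h y (by simpa using hy)
    rw [hFy, Complex.sub_re, Complex.ofReal_re, ← heq] at this
    linarith

theorem nonlinear_of_ae_const {f : L1} {c : ℝ} (hf : ∀ᵐ t ∂arcMeasure, f t = c)
    (hc : Real.sin (Real.pi * c) = 0) : nonlinear f = 0 := by
  have hcoef : ∀ k, coeff f k = if k = 0 then (c : ℂ) else 0 := fun k => by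
    rw [coeff_eq_fcoef, fcoef_congr hf, fcoef_const]
  have hmean : mean f = c := by
    have := coeff_zero f
    rw [hcoef, if_pos rfl] at this
    exact_mod_cast this.symm
  have hhardy : ∀ z, hardy f z = 0 := fun z => by
    rw [hardy]
    convert tsum_zero with k
    rw [hcoef, if_neg (by omega), zero_mul]
  refine nonlinear_eq_of_hasSum (fun k => by simp) ?_ fun z _ => ?_
  · rw [hmean, hc]
    simp
  · rw [expHardy, hhardy, mul_zero, Complex.exp_zero, sub_self, mul_zero]
    simp

/-- Every positive sequence with `s₀ ≤ 2` is the sequence of nonlinear coefficients of a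
fuzzy set. -/
theorem exists_nonlinear_eq {s : ℤ → ℂ} (hs : PosToeplitz s) (h2 : (s 0).re ≤ 2) :
    ∃ f ∈ fuzzySets, nonlinear f = s := by
  rcases hs.re_zero_nonneg.eq_or_lt with h0 | h0
  · have hs0 : s = 0 := by
      have hnat : ∀ k : ℕ, s k = 0 := fun k => by
        have := hs.norm_le k
        rw [← h0] at this
        exact norm_le_zero_iff.mp this
      funext k
      obtain ⟨m, rfl | rfl⟩ := k.eq_nat_or_neg
      · exact hnat m
      · rw [hs.isHermitianSeq, hnat, map_zero, Pi.zero_apply]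
    have hzero := Lp.coeFn_zero ℝ 1 arcMeasure
    refine ⟨0, ?_, ?_⟩
    · change ∀ᵐ t ∂arcMeasure, (0 : L1) t ∈ Set.Icc (0 : ℝ) 1
      filter_upwards [hzero] with t ht
      rw [ht]
      simp
    · rw [hs0]
      exact nonlinear_of_ae_const (c := 0) hzero (by simp)
  · have hpi := Real.pi_pos
    -- Here `s₀ ≤ 2` is needed. The arcsine selects the solution of `sin(πc) = s₀/2` with `0 < c ≤
    -- 1/2`.
    set c : ℝ := Real.arcsin ((s 0).re / 2) / Real.pi with hc
    have hpc : Real.pi * c = Real.arcsin ((s 0).re / 2) := by rw [hc]; field_simp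
    have hsin : Real.sin (Real.pi * c) = (s 0).re / 2 := by
      rw [hpc, Real.sin_arcsin (by linarith) (by linarith)]
    have hc0 : 0 < Real.pi * c := by rw [hpc]; exact Real.arcsin_pos.mpr (by linarith)
    have hc1 : Real.pi * c ≤ Real.pi / 2 := by rw [hpc]; exact Real.arcsin_le_pi_div_two _
    let G : ℂ → ℂ := fun z => ∑' k : ℕ, s ((k : ℤ) + 1) * z ^ (k + 1)
    have hG : ∀ z : ℂ, ‖z‖ < 1 → HasSum (fun k : ℕ => s ((k : ℤ) + 1) * z ^ (k + 1)) (G z) :=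
      fun z hz => (hs.summable hz).hasSum
    let F : ℂ → ℂ := fun z => rotation c + G z
    have hFs := hasDiskSeries_of_shift (rotation c) hG
    have hF0 : F 0 = rotation c := hFs.apply_zero.symm
    have hrot : (rotation c).re = (s 0).re / 2 := by
      rw [rotation_eq, Complex.add_re, Complex.ofReal_re, Complex.re_ofReal_mul, Complex.I_re,
        mul_zero, add_zero, hsin]
    have hFd : DifferentiableOn ℂ F (Metric.ball 0 1) := hFs.differentiableOn
    have hFpos : ∀ z, ‖z‖ < 1 → 0 < (F z).re := fun z hz => by
      refine re_pos_of_nonneg hFd (fun z hz => ?_) (by rw [hF0, hrot]; linarith) hz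
      have := hs.harmonic_nonneg hz
      simp only [F, Complex.add_re, hrot]
      linarith
    -- The solution of `rotation c * e^{-2πiH} = F` with `H 0 = 0`. The principal branch is
    -- holomorphic here because `Re F > 0`, and `|arg F| < π/2` will place `c + 2 Re H = 1/2 - arg F
    -- / π` in `[0,1]`.
    let H : ℂ → ℂ := fun z =>
      Complex.I / (2 * Real.pi) * (Complex.log (F z) - Complex.log (rotation c))
    have hHd : DifferentiableOn ℂ H (Metric.ball 0 1) :=
      ((hFd.clog fun z hz => Or.inl (hFpos z (by simpa using hz))).sub_const _).const_mul _
    have hHs := hasDiskSeries_of_differentiableOn hHd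
    have hlogrot : Complex.log (rotation c) =
        ((Real.pi / 2 - Real.pi * c : ℝ) : ℂ) * Complex.I := by
      have h1 : rotation c = Complex.exp (((Real.pi / 2 - Real.pi * c : ℝ) : ℂ) * Complex.I) := by
        push_cast
        rw [sub_mul, sub_eq_add_neg, Complex.exp_add, Complex.exp_pi_div_two_mul_I, rotation]
        congr 2
        ring
      rw [h1, Complex.log_exp]
      · simp only [Complex.im_ofReal_mul, Complex.I_im, mul_one]
        linarith
      · simp only [Complex.im_ofReal_mul, Complex.I_im, mul_one]
        linarith
    have hHre : ∀ z, c + 2 * (H z).re = 1 / 2 - Complex.arg (F z) / Real.pi := fun z => by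
      have h1 : H z = ((1 / (2 * Real.pi) : ℝ) : ℂ) *
          (Complex.I * (Complex.log (F z) - Complex.log (rotation c))) := by
        simp only [H]
        push_cast
        ring
      rw [h1, Complex.re_ofReal_mul, Complex.I_mul_re, Complex.sub_im, Complex.log_im, hlogrot,
        Complex.im_ofReal_mul, Complex.I_im]
      field_simp
      ring
    have hmem : ∀ z, ‖z‖ < 1 → c + 2 * (H z).re ∈ Set.Icc (0 : ℝ) 1 := fun z hz => by
      have h1 := Complex.abs_arg_lt_pi_div_two_iff.mpr (Or.inl (hFpos z hz))
      rw [abs_lt] at h1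
      rw [hHre, Set.mem_Icc, sub_nonneg, div_le_iff₀ hpi, sub_le_comm, le_div_iff₀ hpi]
      constructor <;> linarith [h1.1, h1.2]
    have hH0 : H 0 = 0 := by simp only [H, hF0, sub_self, mul_zero]
    obtain ⟨f, hf, hmean, hcoef⟩ := exists_fuzzySet hHs (by rw [hHs.apply_zero, hH0]) hmem
    refine ⟨f, hf, nonlinear_eq_of_hasSum hs.isHermitianSeq ?_ fun z hz => ?_⟩
    · rw [hmean, hsin, hs.zero_eq_re]
      push_cast
      rw [Complex.ofReal_re]
      ring
    · have hardyH : hardy f z = H z := by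
        have h1 := hHs.shift hz
        rw [hHs.apply_zero, hH0, sub_zero] at h1
        exact (hasSum_hardy f hz).unique (h1.congr_fun fun k => by rw [hcoef])
      have h2 : rotation (mean f) * (expHardy f z - 1) = G z := by
        have hFne : F z ≠ 0 := fun h => by
          have := hFpos z hz
          rw [h, Complex.zero_re] at this
          exact lt_irrefl _ this
        have h3 : -(2 * Real.pi * Complex.I) * H z =
            Complex.log (F z) - Complex.log (rotation c) := by
          have hpi' : (Real.pi : ℂ) ≠ 0 := by exact_mod_cast hpi.ne'
          simp only [H]
          field_simp
          linear_combination (-(Complex.log (F z) - Complex.log (rotation c))) * Complex.I_sq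
        rw [expHardy, hardyH, h3, Complex.exp_sub, Complex.exp_log hFne,
          Complex.exp_log (rotation_ne_zero c), hmean, mul_sub,
          mul_div_cancel₀ _ (rotation_ne_zero c)]
        simp only [F]
        ring
      rw [h2]
      exact hG z hz

end FuzzyCircle

/-! ### Partial fractions with poles on the circle, and the weights of an arc system -/

namespace FuzzyCircle

open scoped ComplexConjugate Topology

section Polynomial

open Polynomial

variable {n : ℕ}

/-- The numerator of `ρ + ∑ W_l ζ_l z / (1 - ζ_l z)`. -/
noncomputable def numerator (ρ : ℂ) (ζ W : Fin n → ℂ) : ℂ[X] :=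
  C ρ * ∏ m, (1 - C (ζ m) * X) +
    ∑ l, C (W l * ζ l) * X * ∏ m ∈ Finset.univ.erase l, (1 - C (ζ m) * X)

theorem natDegree_C_mul_X_le_one (a : ℂ) : (C a * X : ℂ[X]).natDegree ≤ 1 :=
  (natDegree_C_mul_le _ _).trans natDegree_X_le

theorem natDegree_one_sub_le (a : ℂ) : (1 - C a * X : ℂ[X]).natDegree ≤ 1 := by
  refine (natDegree_sub_le _ _).trans ?_
  simpa using natDegree_C_mul_X_le_one a

theorem natDegree_prod_one_sub_le (S : Finset (Fin n)) (ζ : Fin n → ℂ) :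
    (∏ m ∈ S, (1 - C (ζ m) * X)).natDegree ≤ S.card := by
  refine (natDegree_prod_le _ _).trans ?_
  simpa using Finset.sum_le_sum fun m (_ : m ∈ S) => natDegree_one_sub_le (ζ m)

theorem coeff_prod_one_sub (S : Finset (Fin n)) (ζ : Fin n → ℂ) :
    (∏ m ∈ S, (1 - C (ζ m) * X)).coeff S.card = ∏ m ∈ S, -ζ m := by
  have := coeff_prod_of_natDegree_le S (fun m => (1 - C (ζ m) * X : ℂ[X])) 1
    fun p _ => natDegree_one_sub_le _
  rw [mul_one] at this
  rw [this]
  exact Finset.prod_congr rfl fun m _ => by simp [coeff_one]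

theorem natDegree_numerator_le (ρ : ℂ) (ζ W : Fin n → ℂ) : (numerator ρ ζ W).natDegree ≤ n := by
  refine natDegree_add_le_of_degree_le ?_ ?_
  · refine (natDegree_C_mul_le _ _).trans ?_
    simpa using natDegree_prod_one_sub_le Finset.univ ζ
  · refine natDegree_sum_le_of_forall_le _ _ fun l _ => ?_
    refine natDegree_mul_le.trans ?_
    have h1 := natDegree_prod_one_sub_le (Finset.univ.erase l) ζ
    rw [Finset.card_erase_of_mem (Finset.mem_univ l), Finset.card_univ, Fintype.card_fin] at h1
    have h2 := natDegree_C_mul_X_le_one (W l * ζ l)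
    have := l.pos
    omega

/-- The coefficient that sees the total mass `∑ W l`; `sum_weight` is read off from it. -/
theorem coeff_numerator (ρ : ℂ) (ζ W : Fin n → ℂ) :
    (numerator ρ ζ W).coeff n = (ρ - ∑ l, W l) * ∏ m, -ζ m := by
  have h1 := coeff_prod_one_sub Finset.univ ζ
  rw [Finset.card_univ, Fintype.card_fin] at h1
  rw [numerator, coeff_add, coeff_C_mul, h1, finsetSum_coeff, sub_mul, sub_eq_add_neg,
    Finset.sum_mul, ← Finset.sum_neg_distrib]
  congr 1
  refine Finset.sum_congr rfl fun l _ => ?_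
  obtain ⟨k, rfl⟩ : ∃ k, n = k + 1 := ⟨n - 1, by have := l.pos; omega⟩
  have h2 := coeff_prod_one_sub (Finset.univ.erase l) ζ
  rw [Finset.card_erase_of_mem (Finset.mem_univ l), Finset.card_univ, Fintype.card_fin,
    Nat.add_sub_cancel] at h2
  rw [mul_assoc, coeff_C_mul, coeff_X_mul, h2, ← Finset.mul_prod_erase _ _ (Finset.mem_univ l)]
  ring

theorem eval_numerator (ρ : ℂ) (ζ W : Fin n → ℂ) (z : ℂ) :
    (numerator ρ ζ W).eval z = ρ * ∏ m, (1 - ζ m * z) +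
      ∑ l, W l * ζ l * z * ∏ m ∈ Finset.univ.erase l, (1 - ζ m * z) := by
  simp [numerator, eval_finsetSum, eval_prod]

/-- The numerator factors if it agrees with the product at enough points. -/
theorem numerator_eq_prod {ρ : ℂ} {ζ W ω x : Fin n → ℂ} (hx : Function.Injective x)
    (hx0 : ∀ r, x r ≠ 0)
    (h : ∀ r, (numerator ρ ζ W).eval (x r) = ρ * ∏ m, (1 - ω m * x r)) :
    numerator ρ ζ W = C ρ * ∏ m, (1 - C (ω m) * X) := by
  have hdeg : (C ρ * ∏ m, (1 - C (ω m) * X)).natDegree ≤ n := by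
    refine (natDegree_C_mul_le _ _).trans ?_
    simpa using natDegree_prod_one_sub_le Finset.univ ω
  -- Degree at most `n` requires `n + 1` points. The additional one is `0`, where both sides equal
  -- `ρ`.
  let y : Option (Fin n) → ℂ := fun o => o.elim 0 x
  have hy : Function.Injective y := by
    rintro (_ | i) (_ | j) hij
    · rfl
    · exact absurd hij.symm (hx0 j)
    · exact absurd hij (hx0 i)
    · exact congrArg some (hx hij)
  refine eq_of_natDegree_lt_card_of_eval_eq _ _ hy (fun o => ?_) ?_
  · rcases o with _ | r
    · simp [y, eval_numerator, eval_prod]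
    · simp only [y, Option.elim_some]
      rw [h]
      simp [eval_prod]
  · rw [Fintype.card_option, Fintype.card_fin]
    exact max_lt (Nat.lt_succ_of_le (natDegree_numerator_le _ _ _)) (Nat.lt_succ_of_le hdeg)

end Polynomial

section Atoms

variable {n : ℕ}

theorem one_sub_ne_zero_of_norm {ζ z : ℂ} (hζ : ‖ζ‖ = 1) (hz : ‖z‖ < 1) : 1 - ζ * z ≠ 0 := by
  intro h
  have : ‖ζ * z‖ = 1 := by rw [← sub_eq_zero.mp h, norm_one]
  rw [norm_mul, hζ, one_mul] at this
  exact hz.ne this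

theorem hasSum_atoms {ζ W : Fin n → ℂ} (hζ : ∀ l, ‖ζ l‖ = 1) {z : ℂ} (hz : ‖z‖ < 1) :
    HasSum (fun k : ℕ => (∑ l, W l * ζ l ^ (k + 1)) * z ^ (k + 1))
      (∑ l, W l * ζ l * z / (1 - ζ l * z)) := by
  simp_rw [Finset.sum_mul]
  refine hasSum_sum fun l _ => ?_
  have hlz : ‖ζ l * z‖ < 1 := by rwa [norm_mul, hζ, one_mul]
  refine ((hasSum_geometric_of_norm_lt_one hlz).mul_left (W l * ζ l * z)).congr_fun fun k => ?_
  rw [mul_pow]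
  ring

theorem numerator_div {ρ : ℂ} {ζ W : Fin n → ℂ} (hζ : ∀ l, ‖ζ l‖ = 1) {z : ℂ} (hz : ‖z‖ < 1) :
    (numerator ρ ζ W).eval z / ∏ m, (1 - ζ m * z) = ρ + ∑ l, W l * ζ l * z / (1 - ζ l * z) := by
  have hne : ∀ m, 1 - ζ m * z ≠ 0 := fun m => one_sub_ne_zero_of_norm (hζ m) hz
  have hp : ∏ m, (1 - ζ m * z) ≠ 0 := Finset.prod_ne_zero_iff.mpr fun m _ => hne m
  rw [eval_numerator, add_div, mul_div_cancel_right₀ _ hp, Finset.sum_div]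
  congr 1
  refine Finset.sum_congr rfl fun l _ => ?_
  rw [← Finset.mul_prod_erase _ _ (Finset.mem_univ l), mul_div_mul_right]
  exact Finset.prod_ne_zero_iff.mpr fun m _ => hne m

theorem exists_isAtomic_of_fin {ζ : Fin n → ℂ} {W : Fin n → ℝ} {s : ℤ → ℂ}
    (hinj : Function.Injective ζ) (hζ : ∀ l, ‖ζ l‖ = 1) (hW : ∀ l, 0 < W l)
    (hs : ∀ k : ℤ, s k = ∑ l, (W l : ℂ) * ζ l ^ k) : ∃ S w, IsAtomic s S w ∧ S.card = n := by
  refine ⟨Finset.univ.image ζ, Function.extend ζ W 0, ⟨fun μ hμ => ?_, fun k => ?_⟩, ?_⟩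
  · obtain ⟨l, -, rfl⟩ := Finset.mem_image.mp hμ
    exact ⟨hζ l, by rw [hinj.extend_apply]; exact hW l⟩
  · rw [hs, Finset.sum_image hinj.injOn]
    exact Finset.sum_congr rfl fun l _ => by rw [hinj.extend_apply]
  · rw [Finset.card_image_of_injective _ hinj, Finset.card_univ, Fintype.card_fin]

/-- `e^{ix}`. -/
noncomputable def unitExp (x : ℝ) : ℂ := Complex.exp (x * Complex.I)

theorem norm_unitExp (x : ℝ) : ‖unitExp x‖ = 1 := Complex.norm_exp_ofReal_mul_I x

theorem unitExp_add (x y : ℝ) : unitExp (x + y) = unitExp x * unitExp y := by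
  rw [unitExp, unitExp, unitExp, ← Complex.exp_add]
  push_cast
  ring_nf

theorem unitExp_sub (x y : ℝ) : unitExp (x - y) = unitExp x / unitExp y := by
  rw [unitExp, unitExp, unitExp, ← Complex.exp_sub]
  push_cast
  ring_nf

theorem unitExp_ne_zero (x : ℝ) : unitExp x ≠ 0 := Complex.exp_ne_zero _

theorem unitExp_sum (x : Fin n → ℝ) : unitExp (∑ r, x r) = ∏ r, unitExp (x r) := by
  simp only [unitExp]
  rw [← Complex.exp_sum]
  push_cast
  rw [Finset.sum_mul]

theorem unitExp_neg (x : ℝ) : unitExp (-x) = (unitExp x)⁻¹ := by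
  rw [unitExp, unitExp, ← Complex.exp_neg]
  push_cast
  ring_nf

theorem unitExp_eq (x : ℝ) : unitExp x = Real.cos x + Real.sin x * Complex.I := by
  rw [unitExp, Complex.exp_mul_I, Complex.ofReal_cos, Complex.ofReal_sin]

theorem one_sub_unitExp (x : ℝ) :
    1 - unitExp x = -2 * Complex.I * Real.sin (x / 2) * unitExp (x / 2) := by
  have h1 : unitExp x = unitExp (x / 2) * unitExp (x / 2) := by
    rw [← unitExp_add, add_halves]
  have h2 : (Real.sin (x / 2) : ℂ) ^ 2 + (Real.cos (x / 2) : ℂ) ^ 2 = 1 := by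
    exact_mod_cast Real.sin_sq_add_cos_sq (x / 2)
  rw [h1, unitExp_eq]
  linear_combination (-1) * h2 + (Real.sin (x / 2) : ℂ) ^ 2 * Complex.I_sq

theorem unitExp_injOn {x y : ℝ} (h : unitExp x = unitExp y) (hxy : |x - y| < 2 * Real.pi) :
    x = y := by
  have h1 : unitExp (x - y) = 1 := by rw [unitExp_sub, h, div_self (unitExp_ne_zero y)]
  obtain ⟨k, hk⟩ := Complex.exp_eq_one_iff.mp h1
  have h2 : x - y = k * (2 * Real.pi) := by
    have h3 : ((x - y : ℝ) : ℂ) * Complex.I = ((k * (2 * Real.pi) : ℝ) : ℂ) * Complex.I := by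
      rw [hk]
      push_cast
      ring
    exact_mod_cast mul_right_cancel₀ Complex.I_ne_zero h3
  rw [h2, abs_mul, abs_of_pos Real.two_pi_pos] at hxy
  have h4 : |(k : ℝ)| < 1 := by
    have := Real.two_pi_pos
    by_contra! h5
    nlinarith
  have h5 : k = 0 := Int.abs_lt_one_iff.mp (by exact_mod_cast h4)
  rw [h5, Int.cast_zero, zero_mul] at h2
  linarith

theorem rotation_eq_unitExp (c : ℝ) : rotation c = Complex.I * unitExp (-(Real.pi * c)) := by
  rw [rotation, unitExp]
  push_cast
  ring_nf

end Atoms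

/-- End points of `n` nondegenerate, pairwise disjoint closed arcs in cyclic order. -/
structure IsArcSystem {n : ℕ} (ξ η : Fin n → ℝ) : Prop where
  lt : ∀ r, ξ r < η r
  lt_of_lt : ∀ r r', r < r' → η r < ξ r'
  lt_add : ∀ r r', η r < ξ r' + 2 * Real.pi

namespace IsArcSystem

variable {n : ℕ} {ξ η : Fin n → ℝ}

theorem strictMono_left (h : IsArcSystem ξ η) : StrictMono ξ :=
  fun r r' hr => (h.lt r).trans (h.lt_of_lt r r' hr)

theorem strictMono_right (h : IsArcSystem ξ η) : StrictMono η :=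
  fun r r' hr => (h.lt_of_lt r r' hr).trans (h.lt r')

theorem abs_sub_left_lt (h : IsArcSystem ξ η) (r r' : Fin n) : |ξ r - ξ r'| < 2 * Real.pi := by
  have h1 := h.lt_add r r'
  have h2 := h.lt_add r' r
  have h3 := h.lt r
  have h4 := h.lt r'
  rw [abs_lt]
  constructor <;> linarith

theorem abs_sub_right_lt (h : IsArcSystem ξ η) (r r' : Fin n) : |η r - η r'| < 2 * Real.pi := by
  have h1 := h.lt_add r r'
  have h2 := h.lt_add r' r
  have h3 := h.lt r
  have h4 := h.lt r'
  rw [abs_lt]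
  constructor <;> linarith

theorem injective_left (h : IsArcSystem ξ η) : Function.Injective fun r => unitExp (ξ r) :=
  fun r r' hr => h.strictMono_left.injective (unitExp_injOn hr (h.abs_sub_left_lt r r'))

theorem injective_right (h : IsArcSystem ξ η) : Function.Injective fun r => unitExp (η r) :=
  fun r r' hr => h.strictMono_right.injective (unitExp_injOn hr (h.abs_sub_right_lt r r'))

/-- The masses of the atomic measure of an arc system. -/
noncomputable def weight (ξ η : Fin n → ℝ) (l : Fin n) : ℝ :=
  2 * Real.sin ((η l - ξ l) / 2) *
    ∏ m ∈ Finset.univ.erase l, (Real.sin ((η m - ξ l) / 2) / Real.sin ((ξ m - ξ l) / 2))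

theorem sin_pos (h : IsArcSystem ξ η) (l : Fin n) : 0 < Real.sin ((η l - ξ l) / 2) := by
  have h1 := h.lt l
  have h2 := h.lt_add l l
  exact Real.sin_pos_of_pos_of_lt_pi (by linarith) (by linarith)

/-- The point `ξ l` lies outside the arc `[ξ m, η m]`, so the two half-angles have the same sign,
and both are smaller than `π` in absolute value. -/
theorem sin_div_sin_pos (h : IsArcSystem ξ η) {l m : Fin n} (hlm : m ≠ l) :
    0 < Real.sin ((η m - ξ l) / 2) / Real.sin ((ξ m - ξ l) / 2) := by
  have h1 := h.lt m
  rcases lt_or_gt_of_ne hlm with hlt | hgt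
  · have h2 := h.lt_of_lt m l hlt
    have h3 := h.lt_add l m
    have h4 := h.lt l
    refine div_pos_of_neg_of_neg ?_ ?_ <;>
      exact Real.sin_neg_of_neg_of_neg_pi_lt (by linarith) (by linarith)
  · have h2 := h.strictMono_left hgt
    have h3 := h.lt_add m l
    refine div_pos ?_ ?_ <;> exact Real.sin_pos_of_pos_of_lt_pi (by linarith) (by linarith)

theorem weight_pos (h : IsArcSystem ξ η) (l : Fin n) : 0 < weight ξ η l :=
  mul_pos (mul_pos two_pos (h.sin_pos l))
    (Finset.prod_pos fun _ hm => h.sin_div_sin_pos (Finset.ne_of_mem_erase hm))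

variable (ξ η) in
/-- The normalized total length of an arc system. -/
noncomputable def length : ℝ := (∑ r, (η r - ξ r)) / (2 * Real.pi)

theorem unitExp_length : unitExp (Real.pi * length ξ η) = ∏ r, unitExp ((η r - ξ r) / 2) := by
  rw [← unitExp_sum, length, ← Finset.sum_div]
  congr 1
  field_simp

/-- This compares residues at the pole `e^{-iξ_l}`. Each factor is a real sine times a phase; the
phases `e^{i(η_m - ξ_m)/2}` multiply to `e^{iπ length}`, which `rotation` cancels up to `i`. -/
theorem weight_mul (h : IsArcSystem ξ η) (l : Fin n) :
    (weight ξ η l : ℂ) * ∏ m ∈ Finset.univ.erase l, (1 - unitExp (ξ m) * (unitExp (ξ l))⁻¹) =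
      rotation (length ξ η) * ∏ m, (1 - unitExp (η m) * (unitExp (ξ l))⁻¹) := by
  simp_rw [← div_eq_mul_inv, ← unitExp_sub]
  have hphase : ∀ m, unitExp ((η m - ξ l) / 2) =
      unitExp ((η m - ξ m) / 2) * unitExp ((ξ m - ξ l) / 2) := fun m => by
    rw [← unitExp_add]
    congr 1
    ring
  have h1 : ∏ m ∈ Finset.univ.erase l, (1 - unitExp (η m - ξ l)) =
      (∏ m ∈ Finset.univ.erase l,
        ((Real.sin ((η m - ξ l) / 2) / Real.sin ((ξ m - ξ l) / 2) : ℝ) : ℂ)) *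
      (∏ m ∈ Finset.univ.erase l, unitExp ((η m - ξ m) / 2)) *
      ∏ m ∈ Finset.univ.erase l, (1 - unitExp (ξ m - ξ l)) := by
    rw [← Finset.prod_mul_distrib, ← Finset.prod_mul_distrib]
    refine Finset.prod_congr rfl fun m hm => ?_
    have hne : (Real.sin ((ξ m - ξ l) / 2) : ℂ) ≠ 0 := by
      have := (h.sin_div_sin_pos (Finset.ne_of_mem_erase hm)).ne'
      exact_mod_cast fun h0 => this (by rw [h0, div_zero])
    rw [one_sub_unitExp, one_sub_unitExp, hphase]
    push_cast at hne ⊢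
    field_simp
  have hrot : rotation (length ξ η) * unitExp (Real.pi * length ξ η) = Complex.I := by
    rw [rotation_eq_unitExp, unitExp_neg, mul_assoc, inv_mul_cancel₀ (unitExp_ne_zero _), mul_one]
  rw [unitExp_length, ← Finset.mul_prod_erase _ _ (Finset.mem_univ l)] at hrot
  rw [← Finset.mul_prod_erase _ _ (Finset.mem_univ l), h1, one_sub_unitExp (η l - ξ l), weight]
  push_cast
  linear_combination (2 * Complex.I * Complex.sin ((η l - ξ l) / 2) *
    (∏ m ∈ Finset.univ.erase l, (Complex.sin ((η m - ξ l) / 2) / Complex.sin ((ξ m - ξ l) / 2))) *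
    ∏ m ∈ Finset.univ.erase l, (1 - unitExp (ξ m - ξ l))) * hrot +
    (2 * Complex.sin ((η l - ξ l) / 2) *
    (∏ m ∈ Finset.univ.erase l, (Complex.sin ((η m - ξ l) / 2) / Complex.sin ((ξ m - ξ l) / 2))) *
    ∏ m ∈ Finset.univ.erase l, (1 - unitExp (ξ m - ξ l))) * Complex.I_sq

/-- At `e^{-iξ_r}` only the `r`-th summand of the numerator survives, and `weight_mul` gives its
value. -/
theorem numerator_eq (h : IsArcSystem ξ η) :
    numerator (rotation (length ξ η)) (fun r => unitExp (ξ r)) (fun r => (weight ξ η r : ℂ)) =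
      Polynomial.C (rotation (length ξ η)) *
        ∏ m, (1 - Polynomial.C (unitExp (η m)) * Polynomial.X) := by
  refine numerator_eq_prod (x := fun r => (unitExp (ξ r))⁻¹)
    (inv_injective.comp h.injective_left) (fun r => inv_ne_zero (unitExp_ne_zero _)) fun r => ?_
  rw [eval_numerator, ← h.weight_mul r,
    Finset.prod_eq_zero (Finset.mem_univ r) (by simp [unitExp_ne_zero]), mul_zero, zero_add,
    Finset.sum_eq_single r]
  · rw [mul_assoc (weight ξ η r : ℂ), mul_inv_cancel₀ (unitExp_ne_zero _), mul_one]
  · intro l _ hl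
    rw [Finset.prod_eq_zero (Finset.mem_erase.mpr ⟨hl.symm, Finset.mem_univ r⟩)
      (by simp [unitExp_ne_zero]), mul_zero]
  · simp

/-- Since `∏ e^{iη} = e^{2πi length} ∏ e^{iξ}`, the top coefficients in `numerator_eq` give `∑
weight = i e^{-ix}(1 - e^{2ix}) = 2 sin x` with `x = π length`. -/
theorem sum_weight (h : IsArcSystem ξ η) :
    ∑ l, weight ξ η l = 2 * Real.sin (Real.pi * length ξ η) := by
  have h1 := congrArg (fun p => p.coeff n) h.numerator_eq
  have h2 := coeff_prod_one_sub Finset.univ fun m => unitExp (η m)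
  rw [Finset.card_univ, Fintype.card_fin] at h2
  simp only [coeff_numerator, Polynomial.coeff_C_mul, h2] at h1
  have h3 : ∏ m, -unitExp (η m) =
      unitExp (Real.pi * length ξ η) * unitExp (Real.pi * length ξ η) * ∏ m, -unitExp (ξ m) := by
    rw [unitExp_length, ← Finset.prod_mul_distrib, ← Finset.prod_mul_distrib]
    refine Finset.prod_congr rfl fun m _ => ?_
    rw [← unitExp_add, mul_neg, ← unitExp_add]
    congr 2
    ring
  have h4 : ∏ m, -unitExp (ξ m) ≠ 0 :=
    Finset.prod_ne_zero_iff.mpr fun m _ => neg_ne_zero.mpr (unitExp_ne_zero _)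
  rw [h3, ← mul_assoc] at h1
  have h5 := mul_right_cancel₀ h4 h1
  have h6 : unitExp (-(Real.pi * length ξ η)) * unitExp (Real.pi * length ξ η) = 1 := by
    rw [unitExp_neg, inv_mul_cancel₀ (unitExp_ne_zero _)]
  have h7 : ((∑ l, weight ξ η l : ℝ) : ℂ) = ((2 * Real.sin (Real.pi * length ξ η) : ℝ) : ℂ) := by
    have e1 := unitExp_eq (Real.pi * length ξ η)
    have e2 := unitExp_eq (-(Real.pi * length ξ η))
    rw [Real.cos_neg, Real.sin_neg] at e2
    rw [rotation_eq_unitExp] at h5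
    push_cast at e1 e2 ⊢
    linear_combination (-1 : ℂ) * h5 - Complex.I * unitExp (Real.pi * length ξ η) * h6 +
      Complex.I * e2 - Complex.I * e1 - 2 * Complex.sin (Real.pi * length ξ η) * Complex.I_sq
  exact_mod_cast h7

end IsArcSystem

end FuzzyCircle

/-! ### Nonlinear coefficients of crisp sets -/

namespace FuzzyCircle

open scoped ComplexConjugate Topology

theorem mem_crispSets_iff {n : ℕ} {f : L1} : f ∈ crispSets n ↔ ∃ ξ η : Fin n → ℝ,
    IsArcSystem ξ η ∧ (f : S1 → ℝ) =ᵐ[arcMeasure] (arcUnion ξ η).indicator (fun _ => (1 : ℝ)) :=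
  ⟨fun ⟨ξ, η, h1, h2, h3, h⟩ => ⟨ξ, η, ⟨h1, h2, h3⟩, h⟩,
    fun ⟨ξ, η, ⟨h1, h2, h3⟩, h⟩ => ⟨ξ, η, h1, h2, h3, h⟩⟩

theorem fourier_coe (k : ℤ) (x : ℝ) : (fourier k (x : S1) : ℂ) = unitExp (k * x) := by
  rw [fourier_coe_apply, unitExp]
  congr 1
  have : (Real.pi : ℂ) ≠ 0 := by exact_mod_cast Real.pi_ne_zero
  push_cast
  field_simp

theorem integral_S1 (F : S1 → ℂ) (a : ℝ) : ∫ t, F t ∂arcMeasure =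
    (2 * Real.pi : ℂ)⁻¹ * ∫ x in a..a + 2 * Real.pi, F (x : S1) := by
  rw [AddCircle.integral_haarAddCircle, AddCircle.intervalIntegral_preimage,
    Complex.real_smul]
  push_cast
  rfl

theorem isClosed_arcUnion {n : ℕ} (ξ η : Fin n → ℝ) : IsClosed (arcUnion ξ η) :=
  isClosed_iUnion_of_finite fun _ =>
    (isCompact_Icc.image (AddCircle.continuous_mk' _)).isClosed

namespace IsArcSystem

variable {n : ℕ} {ξ η : Fin n → ℝ}

/-- The circle is cut at the midpoint of the gap between the last arc, moved back by one turn, and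
the first arc; no arc then crosses the cut. -/
theorem exists_base (h : IsArcSystem ξ η) :
    ∃ a, (∀ r, a < ξ r) ∧ ∀ r, η r < a + 2 * Real.pi := by
  rcases n with _ | n
  · exact ⟨0, fun r => r.elim0, fun r => r.elim0⟩
  · have h0 := h.lt_add (Fin.last n) 0
    refine ⟨(ξ 0 + (η (Fin.last n) - 2 * Real.pi)) / 2, fun r => ?_, fun r => ?_⟩
    · have := h.strictMono_left.monotone (Fin.zero_le r)
      linarith
    · have := h.strictMono_right.monotone (Fin.le_last r)
      linarith

theorem mem_arcUnion_iff {a : ℝ} (h1 : ∀ r, a < ξ r) (h2 : ∀ r, η r < a + 2 * Real.pi) {x : ℝ}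
    (hx : x ∈ Set.Ioc a (a + 2 * Real.pi)) :
    (x : S1) ∈ arcUnion ξ η ↔ ∃ r, x ∈ Set.Icc (ξ r) (η r) := by
  simp only [arcUnion, Set.mem_iUnion, Set.mem_image]
  constructor
  · rintro ⟨r, y, hy, hxy⟩
    refine ⟨r, ?_⟩
    obtain rfl := (AddCircle.coe_eq_coe_iff_of_mem_Ioc (p := 2 * Real.pi) (a := a)
      ⟨(h1 r).trans_le hy.1, hy.2.trans (h2 r).le⟩ hx).mp hxy
    exact hy
  · rintro ⟨r, hr⟩
    exact ⟨r, x, hr, rfl⟩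

theorem indicator_eq_sum (h : IsArcSystem ξ η) {a : ℝ} (h1 : ∀ r, a < ξ r)
    (h2 : ∀ r, η r < a + 2 * Real.pi) {x : ℝ} (hx : x ∈ Set.Ioc a (a + 2 * Real.pi)) :
    (arcUnion ξ η).indicator (fun _ => (1 : ℝ)) (x : S1) =
      ∑ r, (Set.Icc (ξ r) (η r)).indicator (fun _ => (1 : ℝ)) x := by
  by_cases hmem : ∃ r, x ∈ Set.Icc (ξ r) (η r)
  · obtain ⟨r, hr⟩ := hmem
    rw [Set.indicator_of_mem ((mem_arcUnion_iff h1 h2 hx).mpr ⟨r, hr⟩), Finset.sum_eq_single r,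
      Set.indicator_of_mem hr]
    · intro r' _ hne
      refine Set.indicator_of_notMem (fun hr' => ?_) _
      rcases lt_or_gt_of_ne hne with hlt | hgt
      · exact absurd (h.lt_of_lt r' r hlt) (not_lt.mpr (hr.1.trans hr'.2))
      · exact absurd (h.lt_of_lt r r' hgt) (not_lt.mpr (hr'.1.trans hr.2))
    · simp
  · rw [Set.indicator_of_notMem (fun hx' => hmem ((mem_arcUnion_iff h1 h2 hx).mp hx'))]
    push Not at hmem
    exact (Finset.sum_eq_zero fun r _ => Set.indicator_of_notMem (hmem r) _).symm

theorem fcoef_indicator (h : IsArcSystem ξ η) (k : ℤ) :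
    fcoef ((arcUnion ξ η).indicator fun _ => (1 : ℝ)) k =
      (2 * Real.pi : ℂ)⁻¹ * ∑ r, ∫ x in ξ r..η r, unitExp (k * x) := by
  obtain ⟨a, h1, h2⟩ := h.exists_base
  have hpi := Real.two_pi_pos
  have hcont : Continuous fun x : ℝ => unitExp (k * x) := by
    unfold unitExp
    fun_prop
  rw [fcoef, integral_S1 _ a, intervalIntegral.integral_of_le (by linarith)]
  congr 1
  have e1 : ∫ x in Set.Ioc a (a + 2 * Real.pi),
      (((arcUnion ξ η).indicator (fun _ => (1 : ℝ)) (x : S1) : ℝ) : ℂ) * fourier k (x : S1) =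
      ∫ x in Set.Ioc a (a + 2 * Real.pi),
        ∑ r, (Set.Icc (ξ r) (η r)).indicator (fun x => unitExp (k * x)) x := by
    refine setIntegral_congr_fun measurableSet_Ioc fun x hx => ?_
    rw [h.indicator_eq_sum h1 h2 hx, fourier_coe]
    push_cast
    rw [Finset.sum_mul]
    refine Finset.sum_congr rfl fun r _ => ?_
    by_cases hr : x ∈ Set.Icc (ξ r) (η r)
    · rw [Set.indicator_of_mem hr, Set.indicator_of_mem hr, Complex.ofReal_one, one_mul]
    · rw [Set.indicator_of_notMem hr, Set.indicator_of_notMem hr, Complex.ofReal_zero, zero_mul]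
  rw [e1, integral_finsetSum]
  · refine Finset.sum_congr rfl fun r _ => ?_
    rw [setIntegral_indicator measurableSet_Icc, intervalIntegral.integral_of_le (h.lt r).le,
      ← integral_Icc_eq_integral_Ioc]
    congr 2
    refine Set.inter_eq_right.mpr fun x hx => ⟨(h1 r).trans_le hx.1, hx.2.trans (h2 r).le⟩
  · intro r _
    exact (hcont.integrableOn_Icc.integrable_indicator measurableSet_Icc).integrableOn

variable {f : L1}

theorem mean_eq (h : IsArcSystem ξ η)
    (hf : (f : S1 → ℝ) =ᵐ[arcMeasure] (arcUnion ξ η).indicator (fun _ => (1 : ℝ))) :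
    mean f = length ξ η := by
  have h1 := coeff_zero f
  rw [coeff_eq_fcoef, fcoef_congr hf, h.fcoef_indicator] at h1
  simp only [Int.cast_zero, zero_mul, unitExp, Complex.ofReal_zero, Complex.exp_zero,
    intervalIntegral.integral_const, Complex.real_smul, mul_one] at h1
  have h2 : ((length ξ η : ℝ) : ℂ) = mean f := by
    rw [← h1, length]
    push_cast
    ring
  exact_mod_cast h2.symm

theorem coeff_succ_eq (h : IsArcSystem ξ η)
    (hf : (f : S1 → ℝ) =ᵐ[arcMeasure] (arcUnion ξ η).indicator (fun _ => (1 : ℝ))) (k : ℕ) :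
    -(2 * Real.pi * Complex.I) * coeff f ((k : ℤ) + 1) =
      ∑ r, (unitExp (ξ r) ^ (k + 1) / (k + 1) - unitExp (η r) ^ (k + 1) / (k + 1)) := by
  rw [coeff_eq_fcoef, fcoef_congr hf, h.fcoef_indicator]
  have hpi : (Real.pi : ℂ) ≠ 0 := by exact_mod_cast Real.pi_ne_zero
  have hk : (k : ℂ) + 1 ≠ 0 := by exact_mod_cast k.succ_ne_zero
  have hpow : ∀ x : ℝ, unitExp x ^ (k + 1) = Complex.exp (((k : ℂ) + 1) * Complex.I * x) :=
    fun x => by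
      rw [unitExp, ← Complex.exp_nat_mul]
      push_cast
      ring_nf
  have hint : ∀ r, ∫ x in ξ r..η r, unitExp (((k : ℤ) + 1 : ℤ) * x) =
      (unitExp (η r) ^ (k + 1) - unitExp (ξ r) ^ (k + 1)) / (((k : ℂ) + 1) * Complex.I) := by
    intro r
    have e1 : ∀ x : ℝ, unitExp (((k : ℤ) + 1 : ℤ) * x) =
        Complex.exp (((k : ℂ) + 1) * Complex.I * x) := fun x => by
      rw [unitExp]
      push_cast
      ring_nf
    simp_rw [e1]
    rw [integral_exp_mul_complex (mul_ne_zero hk Complex.I_ne_zero), hpow, hpow]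
  simp_rw [hint]
  rw [← mul_assoc, Finset.mul_sum]
  refine Finset.sum_congr rfl fun r _ => ?_
  have := Complex.I_ne_zero
  field_simp
  ring

/-- Integrating `e^{ikt}` over an arc turns `-2πi h` into a sum of logarithmic series, one for each
end point. -/
theorem expHardy_eq (h : IsArcSystem ξ η)
    (hf : (f : S1 → ℝ) =ᵐ[arcMeasure] (arcUnion ξ η).indicator (fun _ => (1 : ℝ))) {z : ℂ}
    (hz : ‖z‖ < 1) :
    expHardy f z = (∏ r, (1 - unitExp (η r) * z)) / ∏ r, (1 - unitExp (ξ r) * z) := by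
  have hlog : ∀ x : ℝ, HasSum (fun k : ℕ => unitExp x ^ (k + 1) / (k + 1) * z ^ (k + 1))
      (-Complex.log (1 - unitExp x * z)) := fun x => by
    have hn : ‖unitExp x * z‖ < 1 := by rwa [norm_mul, norm_unitExp, one_mul]
    have := (hasSum_nat_add_iff' 1).mpr (Complex.hasSum_taylorSeries_neg_log hn)
    simp only [Finset.range_one, Finset.sum_singleton, Nat.cast_zero, div_zero, sub_zero] at this
    refine this.congr_fun fun k => ?_
    rw [mul_pow]
    push_cast
    ring
  have h1 : HasSum (fun k : ℕ => -(2 * Real.pi * Complex.I) * (coeff f ((k : ℤ) + 1) * z ^ (k + 1)))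
      (∑ r, (-Complex.log (1 - unitExp (ξ r) * z) - -Complex.log (1 - unitExp (η r) * z))) := by
    refine (hasSum_sum fun r _ => (hlog (ξ r)).sub (hlog (η r))).congr_fun fun k => ?_
    rw [← mul_assoc, h.coeff_succ_eq hf, Finset.sum_mul]
    exact Finset.sum_congr rfl fun r _ => by ring
  have h2 := ((hasSum_hardy f hz).mul_left (-(2 * Real.pi * Complex.I))).unique h1
  rw [expHardy, h2, Complex.exp_sum, ← Finset.prod_div_distrib]
  refine Finset.prod_congr rfl fun r _ => ?_
  rw [sub_neg_eq_add, neg_add_eq_sub, Complex.exp_sub,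
    Complex.exp_log (one_sub_ne_zero_of_norm (norm_unitExp _) hz),
    Complex.exp_log (one_sub_ne_zero_of_norm (norm_unitExp _) hz)]

/-- The partial fraction decomposition of the product in `expHardy_eq`: its poles come from the left
end points, and expanding them in geometric series gives the moments. -/
theorem nonlinear_eq (h : IsArcSystem ξ η)
    (hf : (f : S1 → ℝ) =ᵐ[arcMeasure] (arcUnion ξ η).indicator (fun _ => (1 : ℝ))) (k : ℤ) :
    nonlinear f k = ∑ l, (weight ξ η l : ℂ) * unitExp (ξ l) ^ k := by
  have hmean := h.mean_eq hf
  refine congrFun (nonlinear_eq_of_hasSum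
    (s := fun k => ∑ l, (weight ξ η l : ℂ) * unitExp (ξ l) ^ k)
    (fun k => ?_) ?_ fun z hz => ?_) k
  · simp only [map_sum, map_mul, Complex.conj_ofReal, conj_zpow_of_norm_eq_one (norm_unitExp _)]
  · simp only [zpow_zero, mul_one]
    rw [hmean, ← h.sum_weight]
    push_cast
    rfl
  · have h1 := hasSum_atoms (ζ := fun r => unitExp (ξ r)) (W := fun r => (weight ξ η r : ℂ))
      (fun l => norm_unitExp _) hz
    have h2 := numerator_div (ρ := rotation (length ξ η)) (ζ := fun r => unitExp (ξ r))
      (W := fun r => (weight ξ η r : ℂ)) (fun l => norm_unitExp _) hz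
    rw [h.numerator_eq] at h2
    simp only [Polynomial.eval_mul, Polynomial.eval_C, Polynomial.eval_prod, Polynomial.eval_sub,
      Polynomial.eval_one, Polynomial.eval_X] at h2
    have h3 : rotation (mean f) * (expHardy f z - 1) =
        ∑ l, (weight ξ η l : ℂ) * unitExp (ξ l) * z / (1 - unitExp (ξ l) * z) := by
      rw [h.expHardy_eq hf hz, hmean, mul_sub, mul_one, ← mul_div_assoc, h2]
      ring
    rw [h3]
    refine h1.congr_fun fun k => ?_
    congr 1

/-- The nonlinear coefficients of a crisp set of order `n` form an atomic sequence of order `n`. -/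
theorem exists_isAtomic_nonlinear (h : IsArcSystem ξ η)
    (hf : (f : S1 → ℝ) =ᵐ[arcMeasure] (arcUnion ξ η).indicator (fun _ => (1 : ℝ))) :
    ∃ S w, IsAtomic (nonlinear f) S w ∧ S.card = n :=
  exists_isAtomic_of_fin h.injective_left (fun _ => norm_unitExp _) h.weight_pos (h.nonlinear_eq hf)

end IsArcSystem

theorem nonlinear_mem_seqOfOrder {n : ℕ} {f : L1} (hf : f ∈ crispSets n) :
    nonlinear f ∈ seqOfOrder n := by
  obtain ⟨ξ, η, h, hf⟩ := mem_crispSets_iff.mp hf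
  obtain ⟨S, w, hs, rfl⟩ := h.exists_isAtomic_nonlinear hf
  exact hs.mem_seqOfOrder

theorem crispSets_subset_fuzzySets (n : ℕ) : crispSets n ⊆ fuzzySets := by
  intro f hf
  obtain ⟨ξ, η, -, hf⟩ := mem_crispSets_iff.mp hf
  change ∀ᵐ t ∂arcMeasure, f t ∈ Set.Icc (0 : ℝ) 1
  filter_upwards [hf] with t ht
  rw [ht]
  by_cases h : t ∈ arcUnion ξ η
  · simp [h]
  · simp [h]

/-- Every arc system has a crisp set. -/
theorem exists_crispSet {n : ℕ} (ξ η : Fin n → ℝ) : ∃ f : L1,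
    (f : S1 → ℝ) =ᵐ[arcMeasure] (arcUnion ξ η).indicator (fun _ => (1 : ℝ)) :=
  ⟨indicatorConstLp 1 (isClosed_arcUnion ξ η).measurableSet (measure_ne_top _ _) 1,
    indicatorConstLp_coeFn⟩

end FuzzyCircle

/-! ### Interlacing zeros, and recovery of a crisp set from an atomic sequence -/

namespace FuzzyCircle

open scoped ComplexConjugate Topology

section Zeros

variable {n : ℕ}

/-- The boundary function of the numerator of an atomic Carathéodory function, up to a factor. -/
noncomputable def boundaryTrig (κ : ℝ) (ξ W : Fin n → ℝ) (θ : ℝ) : ℝ :=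
  κ * ∏ m, Real.sin ((θ - ξ m) / 2) - ∑ l, W l / 2 * Real.cos ((θ - ξ l) / 2) *
    ∏ m ∈ Finset.univ.erase l, Real.sin ((θ - ξ m) / 2)

theorem continuous_boundaryTrig (κ : ℝ) (ξ W : Fin n → ℝ) : Continuous (boundaryTrig κ ξ W) := by
  unfold boundaryTrig
  fun_prop

theorem boundaryTrig_apply (κ : ℝ) (ξ W : Fin n → ℝ) (r : Fin n) :
    boundaryTrig κ ξ W (ξ r) =
      -(W r / 2 * ∏ m ∈ Finset.univ.erase r, Real.sin ((ξ r - ξ m) / 2)) := by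
  rw [boundaryTrig, Finset.prod_eq_zero (Finset.mem_univ r) (by simp), mul_zero, zero_sub,
    Finset.sum_eq_single r]
  · simp
  · intro l _ hl
    rw [Finset.prod_eq_zero (Finset.mem_erase.mpr ⟨hl.symm, Finset.mem_univ r⟩) (by simp), mul_zero]
  · simp

/-- The sign `(-1)^n` is what produces a zero in the gap from the last atom to the first one a turn
later. -/
theorem boundaryTrig_add (κ : ℝ) (ξ W : Fin n → ℝ) (θ : ℝ) :
    boundaryTrig κ ξ W (θ + 2 * Real.pi) = (-1) ^ n * boundaryTrig κ ξ W θ := by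
  have e : ∀ x : ℝ, (θ + 2 * Real.pi - x) / 2 = (θ - x) / 2 + Real.pi := fun x => by ring
  simp only [boundaryTrig, e, Real.sin_add_pi, Real.cos_add_pi]
  simp_rw [← neg_one_mul (Real.sin _), Finset.prod_mul_distrib, Finset.prod_const]
  rw [mul_sub, Finset.mul_sum, Finset.card_univ, Fintype.card_fin]
  congr 1
  · ring
  · refine Finset.sum_congr rfl fun l _ => ?_
    rw [Finset.card_erase_of_mem (Finset.mem_univ l), Finset.card_univ, Fintype.card_fin]
    obtain ⟨k, rfl⟩ : ∃ k, n = k + 1 := ⟨n - 1, by have := l.pos; omega⟩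
    rw [Nat.add_sub_cancel, pow_succ]
    ring

/-- Exactly the `n - 1 - r` indices above `r` contribute a negative sine. -/
theorem sign_prod_sin {ξ : Fin n → ℝ} (hξ : StrictMono ξ)
    (hspread : ∀ r r', ξ r < ξ r' + 2 * Real.pi) (r : Fin n) :
    0 < (-1) ^ (n - 1 - (r : ℕ)) * ∏ m ∈ Finset.univ.erase r, Real.sin ((ξ r - ξ m) / 2) := by
  have h1 : (-1 : ℝ) ^ (n - 1 - (r : ℕ)) =
      ∏ m ∈ Finset.univ.erase r, if r < m then (-1 : ℝ) else 1 := by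
    rw [Finset.prod_ite, Finset.prod_const, Finset.prod_const_one, mul_one, ← Fin.card_Ioi]
    congr 2
    ext m
    simp only [Finset.mem_Ioi, Finset.mem_filter, Finset.mem_erase, Finset.mem_univ, and_true]
    exact ⟨fun h => ⟨h.ne', h⟩, fun h => h.2⟩
  rw [h1, ← Finset.prod_mul_distrib]
  refine Finset.prod_pos fun m hm => ?_
  rcases lt_or_gt_of_ne (Finset.ne_of_mem_erase hm) with hlt | hgt
  · rw [if_neg hlt.not_gt, one_mul]
    have := hξ hlt
    have := hspread r m
    exact Real.sin_pos_of_pos_of_lt_pi (by linarith) (by linarith)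
  · rw [if_pos hgt, neg_one_mul, Left.neg_pos_iff]
    have := hξ hgt
    have := hspread m r
    exact Real.sin_neg_of_neg_of_neg_pi_lt (by linarith) (by linarith)

theorem exists_zero_between {g : ℝ → ℝ} (hg : Continuous g) {a b ε : ℝ} (hab : a < b)
    (ha : ε * g a < 0) (hb : 0 < ε * g b) : ∃ x, a < x ∧ x < b ∧ g x = 0 := by
  obtain ⟨x, hx, hgx⟩ := intermediate_value_Ioo hab.le (f := fun x => ε * g x)
    (by fun_prop) ⟨ha, hb⟩
  refine ⟨x, hx.1, hx.2, (mul_eq_zero.mp hgx).resolve_left ?_⟩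
  rintro rfl
  simp at ha

/-- The zeros of the boundary function interlace with the given points. -/
theorem exists_arcSystem_zeros {ξ W : Fin n → ℝ} (κ : ℝ) (hξ : StrictMono ξ)
    (hspread : ∀ r r', ξ r < ξ r' + 2 * Real.pi) (hW : ∀ l, 0 < W l) :
    ∃ η, IsArcSystem ξ η ∧ ∀ r, boundaryTrig κ ξ W (η r) = 0 := by
  rcases n with _ | n
  · exact ⟨fun r => r.elim0, ⟨fun r => r.elim0, fun r => r.elim0, fun r => r.elim0⟩,
      fun r => r.elim0⟩
  have hc := continuous_boundaryTrig κ ξ W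
  -- At an atom a single term survives, so the boundary function alternates in sign from each atom
  -- to the next.
  have hneg : ∀ r : Fin (n + 1), (-1) ^ (n - (r : ℕ)) * boundaryTrig κ ξ W (ξ r) < 0 := fun r => by
    have h1 := sign_prod_sin hξ hspread r
    rw [Nat.add_sub_cancel] at h1
    rw [boundaryTrig_apply]
    have := mul_pos (half_pos (hW r)) h1
    linarith
  have hzero : ∀ r : Fin (n + 1), ∃ x, ξ r < x ∧ (∀ r', r < r' → x < ξ r') ∧
      x < ξ 0 + 2 * Real.pi ∧ boundaryTrig κ ξ W x = 0 := by
    intro r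
    induction r using Fin.lastCases with
    | last =>
      have h1 := hneg (Fin.last n)
      have h2 := hneg 0
      rw [Fin.val_last, Nat.sub_self, pow_zero] at h1
      rw [Fin.val_zero, Nat.sub_zero] at h2
      obtain ⟨x, hx1, hx2, hx3⟩ := exists_zero_between hc (hspread (Fin.last n) 0) h1 (by
        rw [boundaryTrig_add, pow_succ]
        linarith)
      exact ⟨x, hx1, fun r' hr' => absurd hr' (Fin.le_last r').not_gt, hx2, hx3⟩
    | cast r =>
      have h1 := hneg r.castSucc
      have h2 := hneg r.succ
      obtain ⟨x, hx1, hx2, hx3⟩ := exists_zero_between hc (hξ r.castSucc_lt_succ) h1 (by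
        rw [Fin.val_castSucc, show n - (r : ℕ) = (n - (r.succ : ℕ)) + 1 by
          rw [Fin.val_succ]; omega, pow_succ]
        linarith)
      refine ⟨x, hx1, fun r' hr' => hx2.trans_le (hξ.monotone ?_), hx2.trans (hspread _ _), hx3⟩
      exact Fin.castSucc_lt_iff_succ_le.mp hr'
  choose η h1 h2 h3 h4 using hzero
  refine ⟨η, ⟨h1, h2, fun r r' => (h3 r).trans_le ?_⟩, h4⟩
  have := hξ.monotone (Fin.zero_le r')
  linarith

/-- On the circle each `1 - e^{iξ}z` is a real sine times a phase factor. The mass condition makes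
the `sin(πc)` of `rotation c` cancel against half the sum of the masses, leaving `i` times a real
function. -/
theorem eval_numerator_unitExp (c : ℝ) (ξ W : Fin n → ℝ)
    (hW : ∑ l, W l = 2 * Real.sin (Real.pi * c)) (θ : ℝ) :
    (numerator (rotation c) (fun r => unitExp (ξ r)) (fun r => (W r : ℂ))).eval (unitExp θ)⁻¹ =
      Complex.I * boundaryTrig (Real.cos (Real.pi * c)) ξ W θ *
        ∏ m, (2 * Complex.I * unitExp (-((θ - ξ m) / 2))) := by
  have hfac : ∀ m, 1 - unitExp (ξ m) * (unitExp θ)⁻¹ =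
      (Real.sin ((θ - ξ m) / 2) : ℂ) * (2 * Complex.I * unitExp (-((θ - ξ m) / 2))) := fun m => by
    rw [← div_eq_mul_inv, ← unitExp_sub, one_sub_unitExp,
      show (ξ m - θ) / 2 = -((θ - ξ m) / 2) by ring, Real.sin_neg]
    push_cast
    ring
  have hterm : ∀ l, unitExp (ξ l) * (unitExp θ)⁻¹ = (-Complex.I / 2 * Real.cos ((θ - ξ l) / 2) -
      Real.sin ((θ - ξ l) / 2) / 2) * (2 * Complex.I * unitExp (-((θ - ξ l) / 2))) := fun l => by
    rw [← div_eq_mul_inv, ← unitExp_sub, show ξ l - θ = -((θ - ξ l) / 2) + -((θ - ξ l) / 2) by ring,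
      unitExp_add]
    nth_rewrite 2 [unitExp_eq]
    rw [Real.cos_neg, Real.sin_neg]
    push_cast
    linear_combination (unitExp (-((θ - ξ l) / 2)) * Complex.cos ((θ - ξ l) / 2)) * Complex.I_sq
  set P : ℂ := ∏ m, (2 * Complex.I * unitExp (-((θ - ξ m) / 2))) with hP
  have hsum : ∀ l, (W l : ℂ) * unitExp (ξ l) * (unitExp θ)⁻¹ *
      ∏ m ∈ Finset.univ.erase l, (1 - unitExp (ξ m) * (unitExp θ)⁻¹) =
      (-(W l / 2) * ∏ m, (Real.sin ((θ - ξ m) / 2) : ℂ) - Complex.I * (W l / 2 *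
        Real.cos ((θ - ξ l) / 2) *
        ∏ m ∈ Finset.univ.erase l, (Real.sin ((θ - ξ m) / 2) : ℂ))) * P := fun l => by
    rw [mul_assoc (W l : ℂ), hterm, hP,
      ← Finset.mul_prod_erase _ (fun m => 2 * Complex.I * unitExp (-((θ - ξ m) / 2)))
        (Finset.mem_univ l),
      ← Finset.mul_prod_erase _ (fun m => (Real.sin ((θ - ξ m) / 2) : ℂ)) (Finset.mem_univ l)]
    simp_rw [hfac, Finset.prod_mul_distrib]
    ring
  rw [eval_numerator]
  rw [Finset.sum_congr rfl fun l _ => hsum l, ← Finset.sum_mul, Finset.sum_sub_distrib,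
    ← Finset.sum_mul, ← Finset.mul_sum, Finset.sum_neg_distrib, ← Finset.sum_div]
  simp_rw [hfac, Finset.prod_mul_distrib (f := fun m => (Real.sin ((θ - ξ m) / 2) : ℂ))]
  rw [← hP, rotation_eq, boundaryTrig]
  have hW' : ∑ l, (W l : ℂ) = 2 * Real.sin (Real.pi * c) := by exact_mod_cast hW
  rw [hW']
  push_cast
  ring

end Zeros

/-- The atoms of an atomic measure on the circle, in cyclic order. -/
theorem IsAtomic.exists_angles {s : ℤ → ℂ} {S : Finset ℂ} {w : ℂ → ℝ} (h : IsAtomic s S w) :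
    ∃ ξ W : Fin S.card → ℝ, StrictMono ξ ∧ (∀ r r', ξ r < ξ r' + 2 * Real.pi) ∧ (∀ l, 0 < W l) ∧
      ∀ k : ℤ, s k = ∑ l, (W l : ℂ) * unitExp (ξ l) ^ k := by
  have hexp : ∀ μ ∈ S, unitExp (Complex.arg μ) = μ := fun μ hμ => by
    have := Complex.norm_mul_exp_arg_mul_I μ
    rwa [(h.1 μ hμ).1, Complex.ofReal_one, one_mul] at this
  have hinj : Set.InjOn Complex.arg S := fun μ hμ ν hν heq => by
    rw [← hexp μ hμ, ← hexp ν hν, heq]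
  have hcard : (S.image Complex.arg).card = S.card := Finset.card_image_of_injOn hinj
  let ξ : Fin S.card ↪o ℝ := (S.image Complex.arg).orderEmbOfFin hcard
  have hmem : ∀ r, ∃ μ ∈ S, Complex.arg μ = ξ r := fun r =>
    Finset.mem_image.mp (Finset.orderEmbOfFin_mem _ hcard r)
  have hmem' : ∀ r, unitExp (ξ r) ∈ S := fun r => by
    obtain ⟨μ, hμ, hr⟩ := hmem r
    rw [← hr, hexp μ hμ]
    exact hμ
  have hspread : ∀ r r', ξ r < ξ r' + 2 * Real.pi := fun r r' => by
    obtain ⟨μ, -, hr⟩ := hmem r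
    obtain ⟨ν, -, hr'⟩ := hmem r'
    rw [← hr, ← hr']
    linarith [Complex.arg_le_pi μ, Complex.neg_pi_lt_arg ν]
  have hinjξ : Function.Injective fun r => unitExp (ξ r) := fun r r' hr => by
    refine ξ.injective (unitExp_injOn hr ?_)
    rw [abs_lt]
    constructor <;> linarith [hspread r r', hspread r' r]
  have himage : Finset.univ.image (fun r => unitExp (ξ r)) = S := by
    refine Finset.eq_of_subset_of_card_le (fun μ hμ => ?_) ?_
    · obtain ⟨r, -, rfl⟩ := Finset.mem_image.mp hμ
      exact hmem' r
    · rw [Finset.card_image_of_injective _ hinjξ, Finset.card_univ, Fintype.card_fin]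
  refine ⟨ξ, fun r => w (unitExp (ξ r)), ξ.strictMono, hspread, fun l => (h.1 _ (hmem' l)).2,
    fun k => ?_⟩
  rw [h.2, ← Finset.sum_image (f := fun μ => (w μ : ℂ) * μ ^ k) hinjξ.injOn, himage]

/-- `e^{-2π i h}` determines `h`. -/
theorem hardy_eq_of_expHardy_eq {f g : L1} (h : ∀ z, ‖z‖ < 1 → expHardy f z = expHardy g z) {z : ℂ}
    (hz : ‖z‖ < 1) : hardy f z = hardy g z := by
  set B := Metric.ball (0 : ℂ) 1 with hB
  have hBo : IsOpen B := Metric.isOpen_ball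
  have hmem : ∀ z, z ∈ B ↔ ‖z‖ < 1 := fun z => by simp [hB]
  -- Equal logarithmic derivatives make the difference of the Hardy functions constant, and both
  -- vanish at `0`.
  have hderiv : ∀ (u : L1) (z : ℂ), z ∈ B →
      deriv (expHardy u) z = expHardy u z * (-(2 * Real.pi * Complex.I) * deriv (hardy u) z) := by
    intro u z hz
    have hd : DifferentiableAt ℂ (hardy u) z :=
      (hasDiskSeries_hardy u).differentiableOn.differentiableAt (hBo.mem_nhds hz)
    exact ((hd.hasDerivAt.const_mul _).cexp).deriv
  have hd : ∀ u, DifferentiableOn ℂ (hardy u) B := fun u => (hasDiskSeries_hardy u).differentiableOn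
  have hdiff : Set.EqOn (deriv fun z => hardy f z - hardy g z) 0 B := by
    intro z hz
    have hev : expHardy f =ᶠ[𝓝 z] expHardy g := by
      filter_upwards [hBo.mem_nhds hz] with y hy
      exact h y ((hmem y).mp hy)
    have h1 := hev.deriv_eq
    rw [hderiv f z hz, hderiv g z hz, h z ((hmem z).mp hz)] at h1
    have h2 := mul_left_cancel₀ Complex.two_pi_I_ne_zero
      (neg_injective (by simpa only [neg_mul] using mul_left_cancel₀ (Complex.exp_ne_zero _) h1))
    rw [deriv_fun_sub ((hd f).differentiableAt (hBo.mem_nhds hz))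
      ((hd g).differentiableAt (hBo.mem_nhds hz)), h2, sub_self, Pi.zero_apply]
  have hconst := hBo.is_const_of_deriv_eq_zero (convex_ball (0 : ℂ) 1).isPreconnected
    ((hd f).sub (hd g)) hdiff ((hmem z).mpr hz) (show (0 : ℂ) ∈ B by simp [hB])
  simp only [Pi.sub_apply, hardy_zero, sub_self] at hconst
  exact sub_eq_zero.mp hconst

/-- Uniqueness of Fourier coefficients of bounded functions. -/
theorem ae_eq_zero_of_fcoef {g : S1 → ℝ} (hg : MemLp g 2 arcMeasure) (h : ∀ k, fcoef g k = 0) :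
    g =ᵐ[arcMeasure] 0 := by
  let u : L2C := hg.ofReal.toLp _
  have hu : u =ᵐ[arcMeasure] fun t => (g t : ℂ) := hg.ofReal.coeFn_toLp
  have hc : ∀ k, fourierCoeff u k = 0 := fun k => by
    rw [← h (-k), fcoef, fourierCoeff]
    refine integral_congr_ae ?_
    filter_upwards [hu] with t ht
    rw [ht, smul_eq_mul, mul_comm]
  have hzero : u = 0 := by
    have h1 := (hasSum_sq_fourierCoeff_norm u).tsum_eq
    simp only [hc, norm_zero, ne_eq, OfNat.ofNat_ne_zero, not_false_eq_true, zero_pow,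
      tsum_zero] at h1
    exact norm_eq_zero.mp (pow_eq_zero_iff two_ne_zero |>.mp h1.symm)
  have hz := Lp.coeFn_zero ℂ 2 arcMeasure
  rw [← hzero] at hz
  filter_upwards [hu, hz] with t ht1 ht2
  rw [ht2, Pi.zero_apply] at ht1
  rw [Pi.zero_apply]
  exact_mod_cast ht1.symm

theorem memLp_of_mem_fuzzySets {f : L1} (hf : f ∈ fuzzySets) : MemLp f 2 arcMeasure := by
  replace hf : ∀ᵐ t ∂arcMeasure, f t ∈ Set.Icc (0 : ℝ) 1 := hf
  refine MemLp.of_bound (Lp.aestronglyMeasurable f) 1 (hf.mono fun t ht => ?_)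
  rw [Real.norm_of_nonneg ht.1]
  exact ht.2

/-- Fuzzy sets with the same Hardy function differ by a constant. -/
theorem ae_eq_add_const {f g : L1} (hf : f ∈ fuzzySets) (hg : g ∈ fuzzySets)
    (h : ∀ z, ‖z‖ < 1 → hardy f z = hardy g z) :
    ∀ᵐ t ∂arcMeasure, f t = g t + (mean f - mean g) := by
  have hcoef : ∀ k : ℕ, coeff f ((k : ℤ) + 1) = coeff g ((k : ℤ) + 1) := fun k =>
    congrFun ((hasDiskSeries_hardy f).congr h |>.unique (hasDiskSeries_hardy g)) (k + 1)
  have hfi := integrable_L1 f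
  have hgi := integrable_L1 g
  set c := mean f - mean g with hc
  have hmem : MemLp (fun t => f t - g t - c) 2 arcMeasure :=
    ((memLp_of_mem_fuzzySets hf).sub (memLp_of_mem_fuzzySets hg)).sub (memLp_const c)
  have hsub : ∀ k, fcoef (fun t => f t - g t - c) k =
      coeff f k - coeff g k - if k = 0 then (c : ℂ) else 0 := fun k => by
    rw [fcoef_sub (g := fun t => f t - g t) (hfi.sub hgi) (integrable_const c),
        fcoef_sub hfi hgi, fcoef_const]
    rfl
  have hnat : ∀ k : ℕ, fcoef (fun t => f t - g t - c) k = 0 := fun k => by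
    rw [hsub]
    cases k with
    | zero =>
      rw [Nat.cast_zero, if_pos rfl, coeff_zero, coeff_zero, hc]
      push_cast
      ring
    | succ k =>
      rw [if_neg (by omega), Nat.cast_succ, hcoef]
      ring
  have hzero := ae_eq_zero_of_fcoef hmem fun k => by
    obtain ⟨m, rfl | rfl⟩ := k.eq_nat_or_neg
    · exact hnat m
    · rw [fcoef_neg, hnat, map_zero]
  filter_upwards [hzero] with t ht
  simp only [Pi.zero_apply] at ht
  linarith

/-- A fuzzy set that differs from a crisp set of mean strictly between `0` and `1` by a constant
is equal to it. -/
theorem ae_eq_indicator {f g : L1} {A : Set S1} (hf : f ∈ fuzzySets)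
    (hg : (g : S1 → ℝ) =ᵐ[arcMeasure] A.indicator (fun _ => (1 : ℝ)))
    (hsin : Real.sin (Real.pi * mean g) ≠ 0) {c : ℝ} (h : ∀ᵐ t ∂arcMeasure, f t = g t + c) :
    (f : S1 → ℝ) =ᵐ[arcMeasure] A.indicator (fun _ => (1 : ℝ)) := by
  replace hf : ∀ᵐ t ∂arcMeasure, f t ∈ Set.Icc (0 : ℝ) 1 := hf
  have hmean : ∀ a : ℝ, (∀ᵐ t ∂arcMeasure, g t = a) → mean g = a := fun a ha => by
    rw [mean, integral_congr_ae ha]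
    simp
  -- If `c < 0`, then `f` would be negative off `A`, so `g = 1` almost everywhere. If `c > 0`, then
  -- `f` would exceed `1` on `A`, so `g = 0` almost everywhere. Both are excluded by `hsin`.
  rcases lt_trichotomy c 0 with hc | hc | hc
  · refine absurd ?_ hsin
    rw [hmean 1]
    · simp
    · filter_upwards [hf, hg, h] with t h1 h2 h3
      by_cases ht : t ∈ A
      · simp [h2, ht]
      · rw [h3, h2, Set.indicator_of_notMem ht] at h1
        linarith [h1.1]
  · filter_upwards [hg, h] with t h2 h3
    rw [h3, h2, hc, add_zero]
  · refine absurd ?_ hsin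
    rw [hmean 0]
    · simp
    · filter_upwards [hf, hg, h] with t h1 h2 h3
      by_cases ht : t ∈ A
      · rw [h3, h2, Set.indicator_of_mem ht] at h1
        linarith [h1.2]
      · simp [h2, ht]

/-- A fuzzy set with nonlinear coefficients of finite order `n ≥ 1` is crisp of order `n`. -/
theorem mem_crispSets_of_mem_seqOfOrder {f : L1} (hf : f ∈ fuzzySets) {n : ℕ} (hn : 1 ≤ n)
    (h : nonlinear f ∈ seqOfOrder n) : f ∈ crispSets n := by
  obtain ⟨S, w, hs, rfl⟩ := exists_isAtomic h
  obtain ⟨ξ, W, hξ, hspread, hW, hsk⟩ := hs.exists_angles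
  set c := mean f with hc
  have hsumW : ∑ l, W l = 2 * Real.sin (Real.pi * c) := by
    have h1 := hsk 0
    rw [nonlinear_zero'] at h1
    simp only [zpow_zero, mul_one] at h1
    exact_mod_cast h1.symm
  -- These zeros are the right end points of the arcs: the numerator of `F` vanishes at each
  -- `e^{-iη_r}` and hence factors like that of the crisp set.
  obtain ⟨η, hη, hzero⟩ := exists_arcSystem_zeros (Real.cos (Real.pi * c)) hξ hspread hW
  have hnum : numerator (rotation c) (fun r => unitExp (ξ r)) (fun r => (W r : ℂ)) =
      Polynomial.C (rotation c) * ∏ m, (1 - Polynomial.C (unitExp (η m)) * Polynomial.X) := by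
    refine numerator_eq_prod (x := fun r => (unitExp (η r))⁻¹)
      (inv_injective.comp hη.injective_right) (fun r => inv_ne_zero (unitExp_ne_zero _)) fun r => ?_
    rw [eval_numerator_unitExp c ξ W hsumW, hzero,
      Finset.prod_eq_zero (i := r) (f := fun m => 1 - unitExp (η m) * (unitExp (η r))⁻¹)
        (Finset.mem_univ r) (by simp [unitExp_ne_zero])]
    simp
  obtain ⟨g, hg⟩ := exists_crispSet ξ η
  have hgc : g ∈ crispSets S.card := mem_crispSets_iff.mpr ⟨ξ, η, hη, hg⟩
  have hexp : ∀ z, ‖z‖ < 1 → expHardy f z = expHardy g z := fun z hz => by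
    have h1 := hasSum_atoms (ζ := fun r => unitExp (ξ r)) (W := fun r => (W r : ℂ))
      (fun l => norm_unitExp _) hz
    have h2 := (hasSum_nonlinear f hz).unique (h1.congr_fun fun k => by
      rw [hsk]
      norm_cast)
    have h3 := numerator_div (ρ := rotation c) (ζ := fun r => unitExp (ξ r))
      (W := fun r => (W r : ℂ)) (fun l => norm_unitExp _) hz
    rw [hnum, ← h2] at h3
    simp only [Polynomial.eval_mul, Polynomial.eval_C, Polynomial.eval_prod, Polynomial.eval_sub,
      Polynomial.eval_one, Polynomial.eval_X] at h3
    rw [hη.expHardy_eq hg hz]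
    refine mul_left_cancel₀ (rotation_ne_zero c) ?_
    rw [← mul_div_assoc, h3]
    ring
  refine mem_crispSets_iff.mpr ⟨ξ, η, hη, ?_⟩
  refine ae_eq_indicator hf hg ?_ (ae_eq_add_const hf (crispSets_subset_fuzzySets _ hgc)
    fun z hz => hardy_eq_of_expHardy_eq hexp hz)
  rw [hη.mean_eq hg]
  -- Order at least `1` enters here: a nonempty sum of positive weights keeps `sin(π length)` away
  -- from zero.
  have hpos : 0 < ∑ l, IsArcSystem.weight ξ η l :=
    Finset.sum_pos (fun l _ => hη.weight_pos l) ⟨⟨0, hn⟩, Finset.mem_univ _⟩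
  rw [hη.sum_weight] at hpos
  linarith

end FuzzyCircle

/-! ### Order zero and the images of the fuzzy and crisp sets -/

namespace FuzzyCircle

theorem zero_mem_seqOfOrder_zero : (0 : ℤ → ℂ) ∈ seqOfOrder 0 := by
  have h : IsAtomic 0 ∅ 0 := ⟨fun μ hμ => absurd hμ (Finset.notMem_empty μ), fun k => by simp⟩
  simpa using h.mem_seqOfOrder

theorem eq_zero_of_mem_seqOfOrder_zero {s : ℤ → ℂ} (hs : s ∈ seqOfOrder 0) : s = 0 := by
  obtain ⟨S, w, h, hS⟩ := exists_isAtomic hs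
  funext k
  rw [h.2, Finset.card_eq_zero.mp hS, Finset.sum_empty, Pi.zero_apply]

theorem nonlinear_zero_re_le (f : L1) : (nonlinear f 0).re ≤ 2 := by
  rw [nonlinear_zero', Complex.ofReal_re]
  linarith [Real.sin_le_one (Real.pi * mean f)]

theorem mem_crispSets_zero {f : L1} : f ∈ crispSets 0 ↔ ∀ᵐ t ∂arcMeasure, f t = 0 := by
  have hempty : ∀ ξ η : Fin 0 → ℝ, (arcUnion ξ η).indicator (fun _ => (1 : ℝ)) = 0 := fun ξ η => by
    rw [arcUnion, Set.iUnion_of_empty, Set.indicator_empty']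
  rw [mem_crispSets_iff]
  constructor
  · rintro ⟨ξ, η, -, h⟩
    rw [hempty] at h
    exact h
  · intro h
    refine ⟨Fin.elim0, Fin.elim0, ⟨fun r => r.elim0, fun r => r.elim0, fun r => r.elim0⟩, ?_⟩
    rw [hempty]
    exact h

/-- Order `0` means `s = 0`, so `sin(πc₀) = 0` and the mean is `0` or `1`. For values in `[0,1]`
this forces `f` to be constant. -/
theorem nonlinear_mem_seqOfOrder_zero_iff {f : L1} (hf : f ∈ fuzzySets) :
    nonlinear f ∈ seqOfOrder 0 ↔
      (∀ᵐ t ∂arcMeasure, f t = 0) ∨ (∀ᵐ t ∂arcMeasure, f t = 1) := by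
  constructor
  · intro h
    have hsin : Real.sin (Real.pi * mean f) = 0 := by
      have h0 := nonlinear_zero' f
      rw [eq_zero_of_mem_seqOfOrder_zero h, Pi.zero_apply, eq_comm, Complex.ofReal_eq_zero] at h0
      linarith
    have hfi := integrable_L1 f
    have hf' : ∀ᵐ t ∂arcMeasure, f t ∈ Set.Icc (0 : ℝ) 1 := hf
    obtain ⟨h0, h1⟩ := mean_mem_Icc hf
    rcases h0.eq_or_lt with h0 | h0
    · left
      exact (integral_eq_zero_iff_of_nonneg_ae (hf'.mono fun t ht => ht.1) hfi).mp h0.symm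
    · right
      have hmean : mean f = 1 := by
        by_contra hne
        refine (Real.sin_pos_of_pos_of_lt_pi (mul_pos Real.pi_pos h0) ?_).ne' hsin
        exact mul_lt_of_lt_one_right Real.pi_pos (lt_of_le_of_ne h1 hne)
      have hint : ∫ t, (1 - f t) ∂arcMeasure = 0 := by
        rw [integral_sub (integrable_const 1) hfi, ← mean, hmean]
        simp
      have := (integral_eq_zero_iff_of_nonneg_ae (hf'.mono fun t ht => sub_nonneg.mpr ht.2)
        ((integrable_const 1).sub hfi)).mp hint
      exact this.mono fun t ht => (sub_eq_zero.mp ht).symm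
  · rintro (h | h)
    · rw [nonlinear_of_ae_const h (by simp)]
      exact zero_mem_seqOfOrder_zero
    · rw [nonlinear_of_ae_const h (by simp)]
      exact zero_mem_seqOfOrder_zero

theorem image_nonlinear_crispSets (n : ℕ) :
    nonlinear '' crispSets n = seqOfOrder n ∩ {s | (s 0).re ≤ 2} := by
  refine Set.Subset.antisymm ?_ ?_
  · rintro _ ⟨f, hf, rfl⟩
    exact ⟨nonlinear_mem_seqOfOrder hf, nonlinear_zero_re_le f⟩
  · rintro s ⟨hs, h2⟩
    -- Order `0` is treated apart: the constant `1` also has zero coefficients but is not crisp of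
    -- order `0`, so the preimage `0` is named explicitly.
    rcases n.eq_zero_or_pos with rfl | hn
    · have h0 := Lp.coeFn_zero ℝ 1 arcMeasure
      refine ⟨0, mem_crispSets_zero.mpr h0, ?_⟩
      rw [eq_zero_of_mem_seqOfOrder_zero hs, nonlinear_of_ae_const (c := 0) h0 (by simp)]
    · obtain ⟨f, hf, rfl⟩ := exists_nonlinear_eq
        (posToeplitz_iff_mem_seqV.mpr (Or.inl (Set.mem_iUnion.mpr ⟨n, hs⟩))) h2
      exact ⟨f, mem_crispSets_of_mem_seqOfOrder hf hn hs, rfl⟩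

theorem image_nonlinear_fuzzySets :
    nonlinear '' fuzzySets = seqV ∩ {s | (s 0).re ≤ 2} := by
  refine Set.Subset.antisymm ?_ ?_
  · rintro _ ⟨f, hf, rfl⟩
    exact ⟨posToeplitz_iff_mem_seqV.mp (posToeplitz_nonlinear hf), nonlinear_zero_re_le f⟩
  · rintro s ⟨hs, h2⟩
    exact exists_nonlinear_eq (posToeplitz_iff_mem_seqV.mpr hs) h2

end FuzzyCircle

theorem theorem7 :
    -- the image of the fuzzy sets
    nonlinear '' fuzzySets = seqV ∩ {s | (s 0).re ≤ 2} ∧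
    -- the image of the crisp sets of order `n`
    (∀ n : ℕ, nonlinear '' crispSets n = seqOfOrder n ∩ {s | (s 0).re ≤ 2}) ∧
    -- finite order characterizes the crisp sets of finite order
    (∀ f ∈ fuzzySets, ∀ n : ℕ, 1 ≤ n → (nonlinear f ∈ seqOfOrder n ↔ f ∈ crispSets n)) ∧
    (∀ f ∈ fuzzySets, nonlinear f ∈ seqOfOrder 0 ↔
      (∀ᵐ t ∂arcMeasure, f t = 0) ∨ (∀ᵐ t ∂arcMeasure, f t = 1)) :=
  ⟨image_nonlinear_fuzzySets, image_nonlinear_crispSets, fun _ hf _ hn =>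
    ⟨mem_crispSets_of_mem_seqOfOrder hf hn, nonlinear_mem_seqOfOrder⟩,
    fun _ hf => nonlinear_mem_seqOfOrder_zero_iff hf⟩
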